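/- A degree-$k$ pseudo-distribution $\{u\}$ over $\mathbb R^n$ is given by a linear functional $\tilde{\mathbb E}$ on the real polynomials in $u=(u_1,\dots,u_n)$ of degree at most $k$ with $\tilde{\mathbb E}\,1=1$ and $\tilde{\mathbb E}\,P^2\ge 0$ for every $P$ of degree at most $k/2$. It satisfies the constraint $\|u\|_2^2=1$ if $\tilde{\mathbb E}\,(\|u\|_2^2-1)\,Q=0$ for every polynomial $Q$ of degree at most $k-2$. Algorithms are finite programs of a real random-access machine, which in one step performs an exact real operation $+,-,\cdot,/,\sqrt{\ }$, an addition or subtraction of integers, a memory access or a comparison, or draws an independent standard Gaussian number. A pseudo-distribution is given to the machine as the dimension $n$ and the list of the $(n+1)^k$ entries of the moment tensor $\tilde{\mathbb E}\,(1,u)^{\otimes k}$, that is, of all its moments of degree at most $k$. **Theorem (sampling pseudo-distributions).** There are absolute constants $T,A,D\in\mathbb N$ such that for every even $k\ge 2$ there is a randomized algorithm with the following property. Let $n\in\mathbb N$, and let $\{u\}$ be a degree-$k$ pseudo-distribution over $\mathbb R^n$ that satisfies the constraint $\|u\|_2^2=1$. On input $\{u\}$ the algorithm always halts within $\max(n,2)^{Tk}$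 steps (so in time $n^{O(k)}$). Moreover, for every $\epsilon>0$ and every unit vector $c\in\mathbb R^n$ with $\tilde{\mathbb E}\,\langle c,u\rangle^k\ge e^{-\epsilon k}$, with probability at least $2^{-Dk/\epsilon^{D}}$ (that is, $2^{-k/\mathrm{poly}(\epsilon)}$) its output is a unit vector $c'\in\mathbb R^n$ with $\langle c,c'\rangle\ge 1-A\epsilon$. -/

import Mathlib

open MeasureTheory ProbabilityTheory

/-! ### Pseudo-expectations -/

/-- `L` is (an extension to all polynomials of) a degree-`k` pseudo-expectation operator for
`ℝ[u]`, `u = (u₁, …, uₙ)`: a linear functional on the polynomials of degree at most `k` with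
`L 1 = 1` and `L (P ^ 2) ≥ 0` for all `P` of degree at most `k / 2`. The values of `L` on
polynomials of degree larger than `k` are irrelevant: nothing below depends on them. -/
structure IsPseudoExpectation {n : ℕ} (k : ℕ) (L : MvPolynomial (Fin n) ℝ →ₗ[ℝ] ℝ) : Prop where
  map_one : L 1 = 1
  map_sq_nonneg : ∀ P : MvPolynomial (Fin n) ℝ, 2 * P.totalDegree ≤ k → 0 ≤ L (P ^ 2)

/-- The degree-`k` pseudo-distribution with pseudo-expectation `L` satisfies the polynomial
constraint `P = 0`: `L (P * Q) = 0` for every `Q` of degree at most `k - deg P`. -/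
def SatisfiesEqZero {n : ℕ} (k : ℕ) (L : MvPolynomial (Fin n) ℝ →ₗ[ℝ] ℝ)
    (P : MvPolynomial (Fin n) ℝ) : Prop :=
  ∀ Q : MvPolynomial (Fin n) ℝ, P.totalDegree + Q.totalDegree ≤ k → L (P * Q) = 0

/-- The polynomial `‖u‖₂² - 1`. -/
noncomputable def spherePoly (n : ℕ) : MvPolynomial (Fin n) ℝ :=
  ∑ i, MvPolynomial.X i ^ 2 - 1

/-- The linear form `⟨c, u⟩`. -/
noncomputable def linForm {n : ℕ} (c : EuclideanSpace ℝ (Fin n)) : MvPolynomial (Fin n) ℝ :=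
  ∑ i, MvPolynomial.C (c i) * MvPolynomial.X i

/-- The vector `(1, u₁, …, uₙ)` of indeterminates, preceded by the constant `1`. -/
noncomputable def extVar (n : ℕ) : Fin (n + 1) → MvPolynomial (Fin n) ℝ :=
  Fin.cons 1 MvPolynomial.X

/-- The list of all moments of degree at most `k`, written as the tensor
`L ((1, u) ⊗ ⋯ ⊗ (1, u))` of order `k` with `(n + 1) ^ k` entries: the entry at the address
`a = ∑ j < k, i_j * (n + 1) ^ j` with digits `i_j ∈ {0, …, n}` is `L (∏ j < k, u_{i_j})`, where
`u₀ = 1`. There are zeros after the last entry. -/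
noncomputable def momentList {n : ℕ} (k : ℕ) (L : MvPolynomial (Fin n) ℝ →ₗ[ℝ] ℝ) (a : ℕ) : ℝ :=
  if a < (n + 1) ^ k then
    L (∏ j : Fin k, extVar n (Fin.ofNat (n + 1) (a / (n + 1) ^ (j : ℕ))))
  else 0

/-! ### Randomized algorithms: a real RAM with Gaussian random numbers

The machine has integer registers (for addresses and counters), real registers, and a memory of
real cells addressed by integer registers. A step is one operation: exact real arithmetic
`+, -, *, /, √`, addition or truncated subtraction of integers, one memory access, one comparison,
or drawing one fresh standard Gaussian number. Programs are finite and use only integer constants;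
reals cannot be converted to integers. -/

namespace RealRAM

/-- Elementary instructions; all arguments but the value `v` of a constant are register numbers. -/
inductive Instr where
  /-- integer register `r` gets the value `v` -/
  | natConst (r v : ℕ)
  /-- `N[r] := N[a] + N[b]` -/
  | natAdd (r a b : ℕ)
  /-- `N[r] := max (N[a] - N[b]) 0` -/
  | natSub (r a b : ℕ)
  /-- real register `r` gets the value `v` -/
  | realConst (r v : ℕ)
  /-- `R[r] := R[a] + R[b]` -/
  | realAdd (r a b : ℕ)
  /-- `R[r] := R[a] - R[b]` -/
  | realSub (r a b : ℕ)
  /-- `R[r] := R[a] * R[b]` -/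
  | realMul (r a b : ℕ)
  /-- `R[r] := R[a] / R[b]`, with result `0` if `R[b] = 0` -/
  | realDiv (r a b : ℕ)
  /-- `R[r] := √ R[a]`, with result `0` if `R[a] < 0` -/
  | realSqrt (r a : ℕ)
  /-- `R[r] := mem[N[a]]` -/
  | load (r a : ℕ)
  /-- `mem[N[a]] := R[r]` -/
  | store (a r : ℕ)
  /-- `R[r]` gets a fresh standard Gaussian random number -/
  | gauss (r : ℕ)

/-- Comparisons of two integer registers or of two real registers. -/
inductive Test where
  /-- `N[a] < N[b]` -/
  | natLt (a b : ℕ)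
  /-- `R[a] < R[b]` -/
  | realLt (a b : ℕ)

/-- Programs. -/
inductive Program where
  | instr (i : Instr)
  | seq (p q : Program)
  | ite (b : Test) (p q : Program)
  | while (b : Test) (p : Program)

/-- Configurations of the machine; `drawn` counts the random numbers drawn so far. -/
structure State where
  natReg : ℕ → ℕ
  realReg : ℕ → ℝ
  mem : ℕ → ℝ
  drawn : ℕ

namespace State

/-- Overwrite an integer register. -/
def setNat (s : State) (r v : ℕ) : State :=
  { s with natReg := Function.update s.natReg r v }

/-- Overwrite a real register. -/
def setReal (s : State) (r : ℕ) (x : ℝ) : State :=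
  { s with realReg := Function.update s.realReg r x }

end State

/-- The effect of an instruction, where `ω` is the sequence of random numbers. -/
noncomputable def Instr.run (ω : ℕ → ℝ) : Instr → State → State
  | natConst r v, s => s.setNat r v
  | natAdd r a b, s => s.setNat r (s.natReg a + s.natReg b)
  | natSub r a b, s => s.setNat r (s.natReg a - s.natReg b)
  | realConst r v, s => s.setReal r v
  | realAdd r a b, s => s.setReal r (s.realReg a + s.realReg b)
  | realSub r a b, s => s.setReal r (s.realReg a - s.realReg b)
  | realMul r a b, s => s.setReal r (s.realReg a * s.realReg b)
  | realDiv r a b, s => s.setReal r (s.realReg a / s.realReg b)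
  | realSqrt r a, s => s.setReal r (Real.sqrt (s.realReg a))
  | load r a, s => s.setReal r (s.mem (s.natReg a))
  | store a r, s => { s with mem := Function.update s.mem (s.natReg a) (s.realReg r) }
  | gauss r, s => { s.setReal r (ω s.drawn) with drawn := s.drawn + 1 }

/-- Whether a comparison holds. -/
def Test.Holds : Test → State → Prop
  | natLt a b, s => s.natReg a < s.natReg b
  | realLt a b, s => s.realReg a < s.realReg b

/-- `Exec ω p s s' t`: with the random numbers `ω`, the program `p` started in `s` halts in `s'`
after exactly `t` steps. Each instruction and each evaluation of a comparison is one step. -/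
inductive Exec (ω : ℕ → ℝ) : Program → State → State → ℕ → Prop where
  | instr (i : Instr) (s : State) : Exec ω (.instr i) s (i.run ω s) 1
  | seq {p q : Program} {s s' s'' : State} {t t' : ℕ} :
      Exec ω p s s' t → Exec ω q s' s'' t' → Exec ω (.seq p q) s s'' (t + t')
  | ite_true {b : Test} {p q : Program} {s s' : State} {t : ℕ} :
      b.Holds s → Exec ω p s s' t → Exec ω (.ite b p q) s s' (t + 1)
  | ite_false {b : Test} {p q : Program} {s s' : State} {t : ℕ} :
      ¬ b.Holds s → Exec ω q s s' t → Exec ω (.ite b p q) s s' (t + 1)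
  | while_true {b : Test} {p : Program} {s s' s'' : State} {t t' : ℕ} :
      b.Holds s → Exec ω p s s' t → Exec ω (.while b p) s' s'' t' →
        Exec ω (.while b p) s s'' (t + t' + 1)
  | while_false {b : Test} {p : Program} {s : State} :
      ¬ b.Holds s → Exec ω (.while b p) s s 1

/-- The initial configuration on input `n` (in integer register `0`) and the array `x`
(in the memory). -/
def init (n : ℕ) (x : ℕ → ℝ) : State where
  natReg := fun r => if r = 0 then n else 0
  realReg := fun _ => 0
  mem := x
  drawn := 0

/-- The output vector in `ℝⁿ`: the first `n` memory cells. -/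
noncomputable def State.output (n : ℕ) (s : State) : EuclideanSpace ℝ (Fin n) :=
  WithLp.toLp 2 fun i : Fin n => s.mem i

/-- The law of the random numbers: independent standard Gaussians. -/
noncomputable def gaussianSeq : Measure (ℕ → ℝ) :=
  Measure.infinitePi fun _ : ℕ => gaussianReal 0 1

end RealRAM

/-! Write k = 2m + 2 and let L be the pseudo-expectation. The algorithm draws Gaussian vectors g_0,
…, g_m, forms the weight W = ∏_{j<m} ⟨g_j, u⟩², and outputs the normalization of v = L(W ⟨g_m, u⟩
u). The analysis uses only positivity of L on squares of degree at most m + 1 and the sphere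
constraint.

The Gaussians are compared with Gaussians centred at t = τc, where τ² = 1/ε; let ρ be the density of
the shifted law. Under that law W averages to y^m with y = τ²⟨c, u⟩² + 1, modulo the sphere
constraint. The numbers L(y^j) are log-convex, so the assumed lower bound for the k-th moment forces
L(y^m ⟨c, u⟩²) ≥ (1 − 3ε) L(y^m) (`IsSphericalPositive.le_map_pow_mul_sq`): after reweighting, u
lies mostly along ±c. The last factor ⟨g_m, u⟩ breaks the sign symmetry, so that ⟨c, v⟩ has the
positive mean τ L(y^m ⟨c, u⟩²). The squared length of the part of v orthogonal to c is at most a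
product of two nonnegative quantities with known means (`IsSphericalPositive.perpSq_le`).

To return to the unshifted law, the mean of ρ²⟨c, v⟩² is bounded by C^(m+1), where C depends only on
ε (`lintegral_shiftDensities_sq_le`). If the good event had probability below 1/(4C^(m+1)), it could
not carry its share of the mean of ρ⟨c, v⟩; the pointwise form of this argument is
`alongComp_le_indicator`, and integrating it yields `IsSphericalPositive.le_measureReal_good`.

On the machine, v is obtained by contracting the moment tensor in place, one digit at a time, with
the Gaussian vectors (`HoldsTensor.contract`, `halts_sampler`). For large ε every unit vector is
good enough. -/

open MvPolynomial in
/-- The linear form `⟨v, u⟩` of a coordinate vector `v`. -/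
noncomputable def coordForm {n : ℕ} (v : Fin n → ℝ) : MvPolynomial (Fin n) ℝ :=
  ∑ i, C (v i) * X i

/-- The polynomial `‖u‖²`. -/
noncomputable def normSqPoly (n : ℕ) : MvPolynomial (Fin n) ℝ :=
  ∑ i, MvPolynomial.X i ^ 2

/-- A linear functional that is nonnegative on squares of degree at most `2 * d` and respects the
constraint `‖u‖² = 1` up to degree `2 * d`. -/
structure IsSphericalPositive {n : ℕ} (d : ℕ) (L : MvPolynomial (Fin n) ℝ →ₗ[ℝ] ℝ) : Prop where
  map_sq_nonneg : ∀ P : MvPolynomial (Fin n) ℝ, P.totalDegree ≤ d → 0 ≤ L (P ^ 2)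
  sphere : ∀ Q : MvPolynomial (Fin n) ℝ, Q.totalDegree + 2 ≤ 2 * d → L (normSqPoly n * Q) = L Q

/-! ### Degree bounds for linear forms and their products. -/

section Degree

open MvPolynomial

variable {n : ℕ}

theorem totalDegree_coordForm_le (v : Fin n → ℝ) : (coordForm v).totalDegree ≤ 1 := by
  refine totalDegree_finsetSum_le fun i _ => ?_
  refine (totalDegree_mul _ _).trans ?_
  simp

theorem totalDegree_normSqPoly_le (n : ℕ) : (normSqPoly n).totalDegree ≤ 2 := by
  refine totalDegree_finsetSum_le fun i _ => ?_
  refine (totalDegree_pow _ _).trans ?_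
  simp

theorem totalDegree_spherePoly_le (n : ℕ) : (spherePoly n).totalDegree ≤ 2 := by
  refine (totalDegree_sub _ _).trans (max_le (totalDegree_normSqPoly_le n) ?_)
  simp

theorem totalDegree_mul_le_add {P Q : MvPolynomial (Fin n) ℝ} {a b : ℕ}
    (hP : P.totalDegree ≤ a) (hQ : Q.totalDegree ≤ b) : (P * Q).totalDegree ≤ a + b :=
  (totalDegree_mul _ _).trans (add_le_add hP hQ)

theorem totalDegree_pow_le_mul {P : MvPolynomial (Fin n) ℝ} {a : ℕ}
    (hP : P.totalDegree ≤ a) (j : ℕ) : (P ^ j).totalDegree ≤ j * a :=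
  (totalDegree_pow _ _).trans (Nat.mul_le_mul_left j hP)

theorem totalDegree_add_le {P Q : MvPolynomial (Fin n) ℝ} {a : ℕ}
    (hP : P.totalDegree ≤ a) (hQ : Q.totalDegree ≤ a) : (P + Q).totalDegree ≤ a :=
  (totalDegree_add _ _).trans (max_le hP hQ)

theorem totalDegree_sub_le {P Q : MvPolynomial (Fin n) ℝ} {a : ℕ}
    (hP : P.totalDegree ≤ a) (hQ : Q.totalDegree ≤ a) : (P - Q).totalDegree ≤ a :=
  (totalDegree_sub _ _).trans (max_le hP hQ)

theorem totalDegree_C_le (r : ℝ) (a : ℕ) : (C r : MvPolynomial (Fin n) ℝ).totalDegree ≤ a := by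
  simp

theorem totalDegree_prod_coordForm_le {ι : Type*} (s : Finset ι) (g : ι → Fin n → ℝ) :
    (∏ j ∈ s, coordForm (g j)).totalDegree ≤ s.card := by
  refine (totalDegree_finsetProd _ _).trans ?_
  refine (Finset.sum_le_sum fun j _ => totalDegree_coordForm_le (g j)).trans ?_
  simp

/-- The component of `u` orthogonal to `c`, in coordinate `a`. -/
noncomputable def perpForm (c : Fin n → ℝ) (a : Fin n) : MvPolynomial (Fin n) ℝ :=
  X a - C (c a) * coordForm c

theorem totalDegree_perpForm_le (c : Fin n → ℝ) (a : Fin n) : (perpForm c a).totalDegree ≤ 1 := by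
  refine totalDegree_sub_le (by simp) ?_
  exact (totalDegree_mul_le_add (totalDegree_C_le _ 0) (totalDegree_coordForm_le c))

theorem sum_perpForm_sq {c : Fin n → ℝ} (hc : ∑ i, c i ^ 2 = 1) :
    ∑ a, perpForm c a ^ 2 = normSqPoly n - coordForm c ^ 2 := by
  have h1 : ∀ a, perpForm c a ^ 2
      = X a ^ 2 - 2 * coordForm c * (C (c a) * X a) + C (c a ^ 2) * coordForm c ^ 2 := by
    intro a
    simp only [perpForm, C_pow]
    ring
  simp only [h1, Finset.sum_add_distrib, Finset.sum_sub_distrib, ← Finset.mul_sum,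
    ← Finset.sum_mul, ← map_sum, hc]
  change normSqPoly n - 2 * coordForm c * coordForm c + _ = _
  simp
  ring

theorem coordForm_sq (v : Fin n → ℝ) :
    coordForm v ^ 2 = ∑ p : Fin n × Fin n, (v p.1 * v p.2) • (X p.1 * X p.2) := by
  rw [sq, coordForm, Finset.sum_mul_sum, Fintype.sum_prod_type]
  refine Finset.sum_congr rfl fun i _ => Finset.sum_congr rfl fun j _ => ?_
  rw [smul_eq_C_mul, C_mul]
  ring

end Degree

/-! ### Moments of ⟨c, u⟩² under a positive functional. -/

namespace IsSphericalPositive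

open MvPolynomial

variable {n d : ℕ} {L : MvPolynomial (Fin n) ℝ →ₗ[ℝ] ℝ}

theorem mono {e : ℕ} (h : IsSphericalPositive d L) (he : e ≤ d) : IsSphericalPositive e L :=
  ⟨fun P hP => h.map_sq_nonneg P (hP.trans he), fun Q hQ => h.sphere Q (by omega)⟩

theorem cauchy_schwarz (h : IsSphericalPositive d L) {P Q : MvPolynomial (Fin n) ℝ}
    (hP : P.totalDegree ≤ d) (hQ : Q.totalDegree ≤ d) :
    L (P * Q) ^ 2 ≤ L (P ^ 2) * L (Q ^ 2) := by
  have key : ∀ s : ℝ, 0 ≤ L (P ^ 2) * (s * s) + (2 * L (P * Q)) * s + L (Q ^ 2) := by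
    intro s
    have h1 := h.map_sq_nonneg (s • P + Q)
      (totalDegree_add_le ((totalDegree_smul_le _ _).trans hP) hQ)
    have h2 : (s • P + Q) ^ 2 = (s * s) • P ^ 2 + (2 * s) • (P * Q) + Q ^ 2 := by
      simp only [smul_eq_C_mul, C_mul, map_ofNat]
      ring
    rw [h2] at h1
    simp only [map_add, map_smul, smul_eq_mul] at h1
    linarith
  have := discrim_le_zero key
  rw [discrim] at this
  nlinarith

/-- Multiplying by the square of a linear form lowers the degree of positivity by one. -/
theorem mul_sq (h : IsSphericalPositive (d + 1) L) {P : MvPolynomial (Fin n) ℝ}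
    (hP : P.totalDegree ≤ 1) : IsSphericalPositive d (L ∘ₗ LinearMap.mulLeft ℝ (P ^ 2)) where
  map_sq_nonneg Q hQ := by
    have := h.map_sq_nonneg (P * Q) ((totalDegree_mul_le_add hP hQ).trans (by omega))
    simpa [mul_pow] using this
  sphere Q hQ := by
    have := h.sphere (P ^ 2 * Q) (by
      have := totalDegree_mul_le_add (totalDegree_pow_le_mul hP 2) (le_refl Q.totalDegree)
      omega)
    simp only [LinearMap.comp_apply, LinearMap.mulLeft_apply]
    rw [← this]
    congr 1
    ring

/-- `‖u‖²` may be replaced by `1` inside powers of `τ ⟨c, u⟩² + ‖u‖²`. -/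
theorem map_mul_pow_eq (h : IsSphericalPositive d L) (s : ℝ) (c : Fin n → ℝ) (j : ℕ) :
    ∀ Q : MvPolynomial (Fin n) ℝ, Q.totalDegree + 2 * j ≤ 2 * d →
      L (Q * (C s * coordForm c ^ 2 + normSqPoly n) ^ j)
        = L (Q * (C s * coordForm c ^ 2 + 1) ^ j) := by
  have hx : (C s * coordForm c ^ 2).totalDegree ≤ 2 :=
    (totalDegree_mul_le_add (totalDegree_C_le s 0)
      (totalDegree_pow_le_mul (totalDegree_coordForm_le c) 2))
  have hy : (C s * coordForm c ^ 2 + normSqPoly n).totalDegree ≤ 2 :=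
    totalDegree_add_le hx (totalDegree_normSqPoly_le n)
  have hy' : (C s * coordForm c ^ 2 + 1).totalDegree ≤ 2 :=
    totalDegree_add_le hx (by simp)
  induction j with
  | zero => simp
  | succ j ih =>
    intro Q hQ
    have h1 := ih (Q * (C s * coordForm c ^ 2 + normSqPoly n)) (by
      have := totalDegree_mul_le_add (le_refl Q.totalDegree) hy
      omega)
    have h2 := h.sphere (Q * (C s * coordForm c ^ 2 + 1) ^ j) (by
      have := totalDegree_mul_le_add (le_refl Q.totalDegree) (totalDegree_pow_le_mul hy' j)
      omega)
    have h3 : Q * (C s * coordForm c ^ 2 + normSqPoly n) ^ (j + 1)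
        = Q * (C s * coordForm c ^ 2 + normSqPoly n)
          * (C s * coordForm c ^ 2 + normSqPoly n) ^ j := by ring
    have h4 : Q * (C s * coordForm c ^ 2 + normSqPoly n) * (C s * coordForm c ^ 2 + 1) ^ j
        = Q * (C s * coordForm c ^ 2 + 1) ^ (j + 1)
          + (normSqPoly n * (Q * (C s * coordForm c ^ 2 + 1) ^ j)
            - Q * (C s * coordForm c ^ 2 + 1) ^ j) := by ring
    rw [h3, h1, h4, map_add, map_sub, h2]
    ring

/-- Nonnegativity of `(s ⟨c, u⟩² + 1) ^ j * P ^ 2`. -/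
theorem map_pow_mul_sq_nonneg (h : IsSphericalPositive d L) {s : ℝ} (hs : 0 ≤ s)
    (c : Fin n → ℝ) {j : ℕ} {P : MvPolynomial (Fin n) ℝ} (hP : P.totalDegree + j ≤ d) :
    0 ≤ L ((C s * coordForm c ^ 2 + 1) ^ j * P ^ 2) := by
  rw [add_pow, Finset.sum_mul, map_sum]
  refine Finset.sum_nonneg fun i hi => ?_
  have hi' : i ≤ j := Nat.lt_succ_iff.mp (Finset.mem_range.mp hi)
  -- Each binomial term is a nonnegative multiple of a square, also for odd `j`.
  have : (C s * coordForm c ^ 2) ^ i * 1 ^ (j - i) * ((j.choose i : ℕ) : MvPolynomial (Fin n) ℝ)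
      * P ^ 2 = (s ^ i * (j.choose i : ℝ)) • (coordForm c ^ i * P) ^ 2 := by
    rw [smul_eq_C_mul, C_mul, C_pow, map_natCast]
    ring
  rw [this, map_smul, smul_eq_mul]
  refine mul_nonneg (by positivity) (h.map_sq_nonneg _ ?_)
  have := totalDegree_mul_le_add (totalDegree_pow_le_mul (totalDegree_coordForm_le c) i)
    (le_refl P.totalDegree)
  omega

/-- The lower bound for the moments `L (s ⟨c, u⟩² + 1) ^ j` by the leading term. -/
theorem le_map_pow (h : IsSphericalPositive d L) {s : ℝ} (hs : 0 ≤ s)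
    (c : Fin n → ℝ) {j : ℕ} (hj : j ≤ d) :
    s ^ j * L (coordForm c ^ (2 * j)) ≤ L ((C s * coordForm c ^ 2 + 1) ^ j) := by
  rw [add_pow, map_sum, Finset.sum_range_succ]
  have h1 : L ((C s * coordForm c ^ 2) ^ j * 1 ^ (j - j) * ((j.choose j : ℕ) :
      MvPolynomial (Fin n) ℝ)) = s ^ j * L (coordForm c ^ (2 * j)) := by
    rw [← smul_eq_mul (s ^ j), ← map_smul, smul_eq_C_mul, C_pow, pow_mul]
    simp [mul_pow]
  rw [h1, le_add_iff_nonneg_left]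
  refine Finset.sum_nonneg fun i hi => ?_
  have : (C s * coordForm c ^ 2) ^ i * 1 ^ (j - i) * ((j.choose i : ℕ) : MvPolynomial (Fin n) ℝ)
       = (s ^ i * (j.choose i : ℝ)) • (coordForm c ^ i) ^ 2 := by
    rw [smul_eq_C_mul, C_mul, C_pow, map_natCast]
    ring
  rw [this, map_smul, smul_eq_mul]
  refine mul_nonneg (by positivity) (h.map_sq_nonneg _ ?_)
  have := totalDegree_pow_le_mul (totalDegree_coordForm_le c) i
  have := Finset.mem_range.mp hi
  omega

theorem one_le_map_pow (h : IsSphericalPositive d L) (h1 : L 1 = 1) {s : ℝ} (hs : 0 ≤ s)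
    (c : Fin n → ℝ) {j : ℕ} (hj : j ≤ d) : 1 ≤ L ((C s * coordForm c ^ 2 + 1) ^ j) := by
  induction j with
  | zero => simp [h1]
  | succ j ih =>
    have h2 : (C s * coordForm c ^ 2 + 1) ^ (j + 1) = (C s * coordForm c ^ 2 + 1) ^ j
        + s • ((C s * coordForm c ^ 2 + 1) ^ j * coordForm c ^ 2) := by
      rw [smul_eq_C_mul]
      ring
    rw [h2, map_add, map_smul, smul_eq_mul]
    have h3 := h.map_pow_mul_sq_nonneg hs c (j := j) (P := coordForm c) (by
      have := totalDegree_coordForm_le c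
      omega)
    have := ih (by omega)
    have := mul_nonneg hs h3
    linarith

/-- Log-convexity of the moments of `s ⟨c, u⟩² + 1`. -/
theorem map_pow_sq_le (h : IsSphericalPositive d L) {s : ℝ} (hs : 0 ≤ s)
    (c : Fin n → ℝ) {j : ℕ} (hj : j + 2 ≤ d) :
    L ((C s * coordForm c ^ 2 + 1) ^ (j + 1)) ^ 2
      ≤ L ((C s * coordForm c ^ 2 + 1) ^ j) * L ((C s * coordForm c ^ 2 + 1) ^ (j + 2)) := by
  set y : MvPolynomial (Fin n) ℝ := C s * coordForm c ^ 2 + 1 with hy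
  have hy' : y.totalDegree ≤ 2 :=
    totalDegree_add_le ((totalDegree_mul_le_add (totalDegree_C_le s 0)
      (totalDegree_pow_le_mul (totalDegree_coordForm_le c) 2))) (by simp)
  -- `cauchy_schwarz` would need `y ^ j` to be a square. The discriminant of the nonnegative
  -- quadratic L(y^j (ty + 1)²) in t gives the same inequality for every j.
  have key : ∀ t : ℝ, 0 ≤ L (y ^ (j + 2)) * (t * t) + (2 * L (y ^ (j + 1))) * t + L (y ^ j) := by
    intro t
    have h1 := h.map_pow_mul_sq_nonneg hs c (j := j) (P := C t * y + 1) (by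
      have : (C t * y + 1).totalDegree ≤ 2 :=
        totalDegree_add_le (totalDegree_mul_le_add (totalDegree_C_le t 0) hy') (by simp)
      omega)
    rw [← hy] at h1
    have h2 : y ^ j * (C t * y + 1) ^ 2
        = (t * t) • y ^ (j + 2) + (2 * t) • y ^ (j + 1) + y ^ j := by
      simp only [smul_eq_C_mul, C_mul, map_ofNat]
      ring
    rw [h2] at h1
    simp only [map_add, map_smul, smul_eq_mul] at h1
    linarith
  have := discrim_le_zero key
  rw [discrim] at this
  nlinarith

/-- Lyapunov's inequality, from log-convexity and the normalization at exponent 0: raise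
log-convexity to the power j + 1, insert the induction hypothesis, and cancel the common positive
power. -/
theorem map_pow_pow_le (h : IsSphericalPositive d L) (h1 : L 1 = 1) {s : ℝ} (hs : 0 ≤ s)
    (c : Fin n → ℝ) {j : ℕ} (hj : j + 1 ≤ d) :
    L ((C s * coordForm c ^ 2 + 1) ^ j) ^ (j + 1)
      ≤ L ((C s * coordForm c ^ 2 + 1) ^ (j + 1)) ^ j := by
  induction j with
  | zero => simp [h1]
  | succ j ih =>
    have ha := h.one_le_map_pow h1 hs c (j := j) (by omega)
    have hb := h.one_le_map_pow h1 hs c (j := j + 1) (by omega)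
    have hc := h.one_le_map_pow h1 hs c (j := j + 2) (by omega)
    have hm := h.map_pow_sq_le hs c hj
    have ih := ih (by omega)
    generalize L ((C s * coordForm c ^ 2 + 1) ^ j) = a at *
    generalize L ((C s * coordForm c ^ 2 + 1) ^ (j + 1)) = b at *
    change _ ≤ L ((C s * coordForm c ^ 2 + 1) ^ (j + 2)) ^ (j + 1)
    generalize L ((C s * coordForm c ^ 2 + 1) ^ (j + 2)) = e at *
    have h2 : (b ^ 2) ^ (j + 1) ≤ (a * e) ^ (j + 1) := by gcongr
    rw [mul_pow] at h2
    have h3 : a ^ (j + 1) * e ^ (j + 1) ≤ b ^ j * e ^ (j + 1) := by gcongr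
    have h4 : (b ^ 2) ^ (j + 1) = b ^ j * b ^ (j + 1 + 1) := by ring
    have : 0 < b ^ j := by positivity
    exact le_of_mul_le_mul_left (h4 ▸ h2.trans h3) this

/-- A large moment `L ⟨c, u⟩ ^ (2 * (m + 1))` makes `⟨c, u⟩²` close to `1` after reweighting by
the polynomial `(s ⟨c, u⟩² + 1) ^ m`. -/
theorem le_map_pow_mul_sq {m : ℕ} (h : IsSphericalPositive (m + 1) L) (h1 : L 1 = 1) {s : ℝ}
    (hs : 0 < s) (c : Fin n → ℝ) {ε : ℝ}
    (hL : Real.exp (-(2 * ε)) ^ (m + 1) ≤ L (coordForm c ^ (2 * (m + 1)))) :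
    (1 - 2 * ε - s⁻¹) * L ((C s * coordForm c ^ 2 + 1) ^ m)
      ≤ L ((C s * coordForm c ^ 2 + 1) ^ m * coordForm c ^ 2) := by
  have ha := h.one_le_map_pow h1 hs.le c (j := m) (by omega)
  have hb := h.one_le_map_pow h1 hs.le c (j := m + 1) le_rfl
  have h2 := h.le_map_pow hs.le c (j := m + 1) le_rfl
  have h3 := h.map_pow_pow_le h1 hs.le c (j := m) le_rfl
  have h4 : L ((C s * coordForm c ^ 2 + 1) ^ (m + 1)) = L ((C s * coordForm c ^ 2 + 1) ^ m)
        + s * L ((C s * coordForm c ^ 2 + 1) ^ m * coordForm c ^ 2) := by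
    rw [← smul_eq_mul s, ← map_smul, ← map_add, smul_eq_C_mul]
    ring_nf
  -- Compare (m + 1)-st powers: of the m + 1 factors L(y^(m+1)), Lyapunov's inequality spends m on
  -- L(y^m)^(m+1), and the remaining one is bounded below by its leading term s^(m+1) L⟨c,
  -- u⟩^(2m+2).
  have h5 : s * Real.exp (-(2 * ε)) * L ((C s * coordForm c ^ 2 + 1) ^ m)
      ≤ L ((C s * coordForm c ^ 2 + 1) ^ (m + 1)) := by
    refine le_of_pow_le_pow_left₀ (n := m + 1) (by omega) (by linarith) ?_
    rw [mul_pow, mul_pow, pow_succ (L ((C s * coordForm c ^ 2 + 1) ^ (m + 1))), mul_comm]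
    refine mul_le_mul h3 (le_trans (by gcongr) h2) (by positivity) (by positivity)
  have h6 : 1 - 2 * ε ≤ Real.exp (-(2 * ε)) := by
    have := Real.add_one_le_exp (-(2 * ε))
    linarith
  rw [h4] at h5
  have h7 : s * (1 - 2 * ε) * L ((C s * coordForm c ^ 2 + 1) ^ m)
      ≤ s * Real.exp (-(2 * ε)) * L ((C s * coordForm c ^ 2 + 1) ^ m) := by gcongr
  refine le_of_mul_le_mul_left (a := s) ?_ hs
  have h8 : s * ((1 - 2 * ε - s⁻¹) * L ((C s * coordForm c ^ 2 + 1) ^ m))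
      = s * (1 - 2 * ε) * L ((C s * coordForm c ^ 2 + 1) ^ m)
        - L ((C s * coordForm c ^ 2 + 1) ^ m) := by
    field_simp
  rw [h8]
  linarith

end IsSphericalPositive

open MvPolynomial in
/-- A pseudo-expectation that satisfies the sphere constraint. -/
theorem IsPseudoExpectation.isSphericalPositive {n k d : ℕ}
    {L : MvPolynomial (Fin n) ℝ →ₗ[ℝ] ℝ} (h : IsPseudoExpectation k L)
    (hS : SatisfiesEqZero k L (spherePoly n)) (hk : k = 2 * d) : IsSphericalPositive d L where
  map_sq_nonneg P hP := h.map_sq_nonneg P (by omega)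
  sphere Q hQ := by
    have h1 := hS Q (by
      have := totalDegree_spherePoly_le n
      omega)
    have h2 : spherePoly n * Q = normSqPoly n * Q - Q := by
      rw [spherePoly, normSqPoly]
      ring
    rw [h2, map_sub] at h1
    linarith

/-! ### Shifted Gaussian vectors: means and exponential moments. -/

/-- The standard Gaussian measure on `ℝⁿ`. -/
noncomputable def gaussianVec (n : ℕ) : Measure (Fin n → ℝ) :=
  Measure.pi fun _ => gaussianReal 0 1

instance (n : ℕ) : IsProbabilityMeasure (gaussianVec n) := by
  unfold gaussianVec
  infer_instance

/-- The density of the standard Gaussian measure shifted by `t` with respect to the standard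
Gaussian measure. -/
noncomputable def shiftDensity {n : ℕ} (t g : Fin n → ℝ) : ℝ :=
  ∏ i, Real.exp (t i * g i - t i ^ 2 / 2)

section OneDim

/-- Completing the square: the exponential factor is the ratio of the densities of the Gaussians
with means t and 0. -/
theorem integral_exp_mul_gaussianReal_zero_one (t : ℝ) (f : ℝ → ℝ) :
    ∫ x, Real.exp (t * x - t ^ 2 / 2) * f x ∂(gaussianReal 0 1)
      = ∫ x, f x ∂(gaussianReal t 1) := by
  rw [integral_gaussianReal_eq_integral_smul one_ne_zero,
    integral_gaussianReal_eq_integral_smul one_ne_zero]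
  refine integral_congr_ae (Filter.Eventually.of_forall fun x => ?_)
  simp only [smul_eq_mul, ← mul_assoc, gaussianPDFReal]
  congr 1
  rw [mul_assoc, ← Real.exp_add]
  congr 2
  simp
  ring

theorem integrable_exp_mul_pow_gaussianReal (t : ℝ) (e : ℕ) :
    Integrable (fun x => Real.exp (t * x - t ^ 2 / 2) * x ^ e) (gaussianReal 0 1) := by
  have h := integrable_pow_mul_exp_of_mem_interior_integrableExpSet (X := id)
    (μ := gaussianReal 0 1) (v := t) (by simp [integrableExpSet_id_gaussianReal]) e
  refine (h.const_mul (Real.exp (-(t ^ 2 / 2)))).congr (Filter.Eventually.of_forall fun x => ?_)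
  simp only [id, sub_eq_add_neg, Real.exp_add]
  ring

theorem integral_exp_mul_pow_zero (t : ℝ) :
    ∫ x, Real.exp (t * x - t ^ 2 / 2) * x ^ 0 ∂(gaussianReal 0 1) = 1 := by
  rw [integral_exp_mul_gaussianReal_zero_one t (fun x => x ^ 0)]
  simp

theorem integral_exp_mul_pow_one (t : ℝ) :
    ∫ x, Real.exp (t * x - t ^ 2 / 2) * x ^ 1 ∂(gaussianReal 0 1) = t := by
  rw [integral_exp_mul_gaussianReal_zero_one t (fun x => x ^ 1)]
  simp [integral_id_gaussianReal]

theorem integral_exp_mul_pow_two (t : ℝ) :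
    ∫ x, Real.exp (t * x - t ^ 2 / 2) * x ^ 2 ∂(gaussianReal 0 1) = t ^ 2 + 1 := by
  rw [integral_exp_mul_gaussianReal_zero_one t (fun x => x ^ 2)]
  have h := variance_eq_sub (memLp_id_gaussianReal' (μ := t) (v := 1) 2 (by simp))
  rw [variance_id_gaussianReal] at h
  simp only [Pi.pow_apply, id, integral_id_gaussianReal, NNReal.coe_one] at h
  linarith

end OneDim

section Vec

variable {n : ℕ}

theorem continuous_shiftDensity (t : Fin n → ℝ) : Continuous (shiftDensity t) := by
  unfold shiftDensity
  fun_prop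

theorem shiftDensity_pos (t g : Fin n → ℝ) : 0 < shiftDensity t g :=
  Finset.prod_pos fun _ _ => Real.exp_pos _

theorem shiftDensity_mul_prod_pow (t g : Fin n → ℝ) (e : Fin n → ℕ) :
    shiftDensity t g * ∏ i, g i ^ e i
      = ∏ i, Real.exp (t i * g i - t i ^ 2 / 2) * g i ^ e i := by
  rw [shiftDensity, Finset.prod_mul_distrib]

theorem integrable_shiftDensity_mul_prod_pow (t : Fin n → ℝ) (e : Fin n → ℕ) :
    Integrable (fun g => shiftDensity t g * ∏ i, g i ^ e i) (gaussianVec n) := by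
  simp only [shiftDensity_mul_prod_pow]
  exact Integrable.fintype_prod (f := fun i x => Real.exp (t i * x - t i ^ 2 / 2) * x ^ e i)
    fun i => integrable_exp_mul_pow_gaussianReal (t i) (e i)

theorem integral_shiftDensity_mul_prod_pow (t : Fin n → ℝ) (e : Fin n → ℕ) :
    ∫ g, shiftDensity t g * ∏ i, g i ^ e i ∂(gaussianVec n)
      = ∏ i, ∫ x, Real.exp (t i * x - t i ^ 2 / 2) * x ^ e i ∂(gaussianReal 0 1) := by
  simp only [shiftDensity_mul_prod_pow]
  exact integral_fintype_prod_eq_prod (fun i x => Real.exp (t i * x - t i ^ 2 / 2) * x ^ e i)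

theorem integrable_shiftDensity (t : Fin n → ℝ) :
    Integrable (fun g => shiftDensity t g) (gaussianVec n) := by
  simpa using integrable_shiftDensity_mul_prod_pow t 0

theorem integral_shiftDensity (t : Fin n → ℝ) :
    ∫ g, shiftDensity t g ∂(gaussianVec n) = 1 := by
  have h := integral_shiftDensity_mul_prod_pow t 0
  simp only [Pi.zero_apply, integral_exp_mul_pow_zero, Finset.prod_const_one] at h
  simpa using h

theorem prod_pow_single (g : Fin n → ℝ) (a : Fin n) :
    ∏ i, g i ^ (Pi.single a 1 : Fin n → ℕ) i = g a := by
  rw [Finset.prod_eq_single a] <;> simp +contextual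

theorem integrable_shiftDensity_mul_apply (t : Fin n → ℝ) (a : Fin n) :
    Integrable (fun g => shiftDensity t g * g a) (gaussianVec n) := by
  simpa only [prod_pow_single] using integrable_shiftDensity_mul_prod_pow t (Pi.single a 1)

theorem integral_shiftDensity_mul_apply (t : Fin n → ℝ) (a : Fin n) :
    ∫ g, shiftDensity t g * g a ∂(gaussianVec n) = t a := by
  have h := integral_shiftDensity_mul_prod_pow t (Pi.single a 1)
  simp only [prod_pow_single] at h
  rw [h, Finset.prod_eq_single a]
  · simpa using integral_exp_mul_pow_one (t a)
  · intro b _ hb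
    simpa [Pi.single_apply, hb] using integral_exp_mul_pow_zero (t b)
  · simp

theorem prod_pow_single_add_single (g : Fin n → ℝ) (a b : Fin n) :
    ∏ i, g i ^ (Pi.single a 1 + Pi.single b 1 : Fin n → ℕ) i = g a * g b := by
  simp only [Pi.add_apply, pow_add, Finset.prod_mul_distrib, prod_pow_single]

theorem integrable_shiftDensity_mul_mul (t : Fin n → ℝ) (a b : Fin n) :
    Integrable (fun g => shiftDensity t g * (g a * g b)) (gaussianVec n) := by
  have h := integrable_shiftDensity_mul_prod_pow t (Pi.single a 1 + Pi.single b 1)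
  simpa only [prod_pow_single_add_single] using h

theorem integral_shiftDensity_mul_mul (t : Fin n → ℝ) (a b : Fin n) :
    ∫ g, shiftDensity t g * (g a * g b) ∂(gaussianVec n)
      = t a * t b + if a = b then 1 else 0 := by
  have h := integral_shiftDensity_mul_prod_pow t (Pi.single a 1 + Pi.single b 1)
  simp only [prod_pow_single_add_single] at h
  rw [h]
  rcases eq_or_ne a b with rfl | hab
  · rw [Finset.prod_eq_single a]
    · simpa [← sq] using integral_exp_mul_pow_two (t a)
    · intro i _ hi
      simpa [Pi.single_apply, hi] using integral_exp_mul_pow_zero (t i)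
    · simp
  · rw [Finset.prod_eq_mul a b hab]
    · simpa [hab, hab.symm] using
        congrArg₂ (· * ·) (integral_exp_mul_pow_one (t a)) (integral_exp_mul_pow_one (t b))
    · intro i _ hi
      simpa [Pi.single_apply, hi.1, hi.2] using integral_exp_mul_pow_zero (t i)
    · simp
    · simp

theorem shiftDensity_eq (t g : Fin n → ℝ) :
    shiftDensity t g = Real.exp (∑ i, t i * g i) * Real.exp (-((∑ i, t i ^ 2) / 2)) := by
  rw [shiftDensity, ← Real.exp_sum, ← Real.exp_add, Finset.sum_sub_distrib, ← Finset.sum_div,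
    sub_eq_add_neg]

theorem exp_sum_mul_eq (t g : Fin n → ℝ) :
    Real.exp (∑ i, t i * g i) = Real.exp ((∑ i, t i ^ 2) / 2) * shiftDensity t g := by
  rw [shiftDensity_eq, mul_left_comm, ← Real.exp_add]
  simp

theorem integrable_exp_sum_mul (t : Fin n → ℝ) :
    Integrable (fun g => Real.exp (∑ i, t i * g i)) (gaussianVec n) := by
  simp only [exp_sum_mul_eq]
  exact (integrable_shiftDensity t).const_mul _

theorem integral_exp_sum_mul (t : Fin n → ℝ) :
    ∫ g, Real.exp (∑ i, t i * g i) ∂(gaussianVec n) = Real.exp ((∑ i, t i ^ 2) / 2) := by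
  simp only [exp_sum_mul_eq]
  rw [integral_const_mul, integral_shiftDensity, mul_one]

/-- Trading a fourth power for exponentials reduces the second-moment estimates to exponential
moments of a Gaussian vector, which are explicit. -/
theorem pow_four_le_exp_add_exp (x : ℝ) : x ^ 4 ≤ 24 * (Real.exp x + Real.exp (-x)) := by
  have h : |x| ^ 4 / (Nat.factorial 4 : ℕ) ≤ Real.exp |x| :=
    Real.pow_div_factorial_le_exp _ (abs_nonneg x) 4
  have h2 : Real.exp |x| ≤ Real.exp x + Real.exp (-x) := by
    rcases abs_cases x with ⟨h, _⟩ | ⟨h, _⟩ <;> rw [h] <;> linarith [Real.exp_pos x, Real.exp_pos (-x)]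
  have h3 : |x| ^ 4 = x ^ 4 := by
    rw [← abs_pow, abs_of_nonneg (by positivity)]
  have h4 : ((Nat.factorial 4 : ℕ) : ℝ) = 24 := by norm_num [Nat.factorial]
  rw [h3, h4] at h
  linarith

/-- The constant in the bound for the second moments of reweighted quadratic forms. -/
noncomputable def secondMomentConst (s : ℝ) : ℝ := 48 * Real.exp (3 * s + 1)

theorem shiftDensity_sq (t g : Fin n → ℝ) :
    shiftDensity t g ^ 2 = Real.exp (-(∑ i, t i ^ 2)) * Real.exp (∑ i, (2 * t i) * g i) := by
  rw [shiftDensity_eq, ← Real.exp_add, ← Real.exp_add, ← Real.exp_nat_mul]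
  congr 1
  simp only [mul_assoc, ← Finset.mul_sum]
  push_cast
  ring

/-- A pointwise bound that reduces fourth moments to exponential moments. -/
theorem shiftDensity_sq_mul_pow_four_le (t v g : Fin n → ℝ) :
    shiftDensity t g ^ 2 * (∑ i, v i * g i) ^ 4
      ≤ 24 * Real.exp (-(∑ i, t i ^ 2)) * (Real.exp (∑ i, (2 * t i + v i) * g i)
        + Real.exp (∑ i, (2 * t i - v i) * g i)) := by
  rw [shiftDensity_sq]
  have h := pow_four_le_exp_add_exp (∑ i, v i * g i)
  simp only [add_mul, sub_mul, Finset.sum_add_distrib, Finset.sum_sub_distrib]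
  rw [sub_eq_add_neg, Real.exp_add, Real.exp_add]
  have h2 : 0 ≤ Real.exp (-(∑ i, t i ^ 2)) * Real.exp (∑ i, (2 * t i) * g i) := by positivity
  nlinarith [mul_le_mul_of_nonneg_left h h2]

theorem exp_half_sum_sq_le {t v : Fin n → ℝ} {s : ℝ} (ht : ∑ i, t i ^ 2 = s)
    (hv : ∑ i, v i ^ 2 ≤ 1) :
    Real.exp ((∑ i, (2 * t i + v i) ^ 2) / 2) ≤ Real.exp (4 * s + 1) := by
  refine Real.exp_le_exp.mpr ?_
  have : ∑ i, (2 * t i + v i) ^ 2 ≤ ∑ i, (8 * t i ^ 2 + 2 * v i ^ 2) :=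
    Finset.sum_le_sum fun i _ => by nlinarith [sq_nonneg (2 * t i - v i)]
  rw [Finset.sum_add_distrib, ← Finset.mul_sum, ← Finset.mul_sum, ht] at this
  linarith

/-- The second moment of a positive semidefinite quadratic form of a Gaussian vector, reweighted
by the square of a shift density. -/
theorem lintegral_shiftDensity_sq_mul_sq_le {t : Fin n → ℝ} {s : ℝ} (ht : ∑ i, t i ^ 2 = s)
    {N : ℕ} (β : Fin N → ℝ) (v : Fin N → Fin n → ℝ) (hv : ∀ j, ∑ i, v j i ^ 2 ≤ 1) :
    ∫⁻ g, ENNReal.ofReal (shiftDensity t g ^ 2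
        * (∑ j, β j ^ 2 * (∑ i, v j i * g i) ^ 2) ^ 2) ∂(gaussianVec n)
      ≤ ENNReal.ofReal (secondMomentConst s * (∑ j, β j ^ 2) ^ 2) := by
  set F : (Fin n → ℝ) → ℝ := fun g => (∑ j, β j ^ 2) * ∑ j, β j ^ 2 *
    (24 * Real.exp (-s) * (Real.exp (∑ i, (2 * t i + v j i) * g i)
        + Real.exp (∑ i, (2 * t i - v j i) * g i))) with hF
  have hint1 : ∀ j, Integrable (fun g => Real.exp (∑ i, (2 * t i + v j i) * g i))
      (gaussianVec n) := fun j => integrable_exp_sum_mul _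
  have hint2 : ∀ j, Integrable (fun g => Real.exp (∑ i, (2 * t i - v j i) * g i))
      (gaussianVec n) := fun j => integrable_exp_sum_mul _
  have hint : ∀ j, Integrable (fun g => β j ^ 2 * (24 * Real.exp (-s) *
      (Real.exp (∑ i, (2 * t i + v j i) * g i) + Real.exp (∑ i, (2 * t i - v j i) * g i))))
      (gaussianVec n) := fun j => (((hint1 j).add (hint2 j)).const_mul _).const_mul _
  have hFint : Integrable F (gaussianVec n) :=
    (integrable_finsetSum _ fun j _ => hint j).const_mul _
  have hle : ∀ g, shiftDensity t g ^ 2 * (∑ j, β j ^ 2 * (∑ i, v j i * g i) ^ 2) ^ 2 ≤ F g := by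
    intro g
    -- Cauchy–Schwarz with weights β_j² moves the outer square onto the individual linear forms.
    have h1 : (∑ j, β j ^ 2 * (∑ i, v j i * g i) ^ 2) ^ 2
        ≤ (∑ j, β j ^ 2) * ∑ j, β j ^ 2 * (∑ i, v j i * g i) ^ 4 := by
      have := Finset.sum_mul_sq_le_sq_mul_sq Finset.univ β
        (fun j => β j * (∑ i, v j i * g i) ^ 2)
      convert! this using 2
      · exact Finset.sum_congr rfl fun j _ => by ring
      · exact Finset.sum_congr rfl fun j _ => by ring
    refine (mul_le_mul_of_nonneg_left h1 (sq_nonneg _)).trans ?_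
    rw [mul_left_comm, Finset.mul_sum]
    refine mul_le_mul_of_nonneg_left (Finset.sum_le_sum fun j _ => ?_)
      (Finset.sum_nonneg fun j _ => sq_nonneg _)
    rw [mul_left_comm]
    refine mul_le_mul_of_nonneg_left ?_ (sq_nonneg _)
    have := shiftDensity_sq_mul_pow_four_le t (v j) g
    rwa [ht] at this
  have hF0 : ∀ g, 0 ≤ F g := fun g => (mul_nonneg (sq_nonneg _) (sq_nonneg _)).trans (hle g)
  refine (lintegral_mono fun g => ENNReal.ofReal_le_ofReal (hle g)).trans ?_
  rw [← ofReal_integral_eq_lintegral_ofReal hFint (Filter.Eventually.of_forall hF0)]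
  refine ENNReal.ofReal_le_ofReal ?_
  have hT : 0 ≤ ∑ j, β j ^ 2 := Finset.sum_nonneg fun j _ => sq_nonneg _
  have hC : secondMomentConst s * (∑ j, β j ^ 2) ^ 2
      = (∑ j, β j ^ 2) * ∑ j, secondMomentConst s * β j ^ 2 := by
    rw [← Finset.mul_sum]
    ring
  rw [hF, integral_const_mul, integral_finsetSum _ fun j _ => hint j, hC]
  refine mul_le_mul_of_nonneg_left (Finset.sum_le_sum fun j _ => ?_) hT
  rw [integral_const_mul, integral_const_mul, integral_add (hint1 j) (hint2 j),
    integral_exp_sum_mul, integral_exp_sum_mul, mul_comm (secondMomentConst s)]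
  refine mul_le_mul_of_nonneg_left ?_ (sq_nonneg _)
  have h1 := exp_half_sum_sq_le ht (hv j)
  have h2 := exp_half_sum_sq_le (v := -v j) ht (by simpa using hv j)
  simp only [Pi.neg_apply, ← sub_eq_add_neg] at h2
  -- The factor 24 is 4! from the bound on fourth powers, 2 counts the two signs, and e^(-s)
  -- e^(4s+1) = e^(3s+1).
  have h3 : secondMomentConst s = 24 * Real.exp (-s) * (2 * Real.exp (4 * s + 1)) := by
    rw [secondMomentConst, mul_left_comm, ← mul_assoc, ← mul_assoc, mul_assoc (2 * 24),
      ← Real.exp_add]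
    norm_num
    ring_nf
  rw [h3]
  gcongr
  linarith

theorem lintegral_shiftDensity_sq_le {t : Fin n → ℝ} {s : ℝ} (ht : ∑ i, t i ^ 2 = s) :
    ∫⁻ g, ENNReal.ofReal (shiftDensity t g ^ 2) ∂(gaussianVec n)
      ≤ ENNReal.ofReal (secondMomentConst s) := by
  simp only [shiftDensity_sq]
  rw [← ofReal_integral_eq_lintegral_ofReal ((integrable_exp_sum_mul _).const_mul _)
    (Filter.Eventually.of_forall fun g => by positivity), integral_const_mul, integral_exp_sum_mul]
  refine ENNReal.ofReal_le_ofReal ?_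
  rw [← Real.exp_add, secondMomentConst]
  have h1 : ∑ i, (2 * t i) ^ 2 = 4 * s := by
    simp only [mul_pow, ← Finset.mul_sum, ht]
    norm_num
  rw [h1, ht]
  have hs : 0 ≤ s := ht ▸ Finset.sum_nonneg fun i _ => sq_nonneg _
  have : Real.exp (-s + 4 * s / 2) ≤ Real.exp (3 * s + 1) := Real.exp_le_exp.mpr (by linarith)
  linarith [Real.exp_pos (3 * s + 1)]

end Vec

/-! ### The random quadratic form g ↦ L⟨g, u⟩². -/

section Functional

open MvPolynomial

variable {n : ℕ}

theorem coordForm_eq_sum_smul (v : Fin n → ℝ) : coordForm v = ∑ i, v i • X i := by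
  simp only [coordForm, smul_eq_C_mul]

/-- The quadratic form `L ⟨g, u⟩²` is a sum of squares of linear forms. -/
theorem IsSphericalPositive.exists_sum_sq {L : MvPolynomial (Fin n) ℝ →ₗ[ℝ] ℝ}
    (h : IsSphericalPositive 1 L) :
    ∃ (N : ℕ) (β : Fin N → ℝ) (v : Fin N → Fin n → ℝ), (∀ j, ∑ i, v j i ^ 2 ≤ 1) ∧
      (∀ g, L (coordForm g ^ 2) = ∑ j, β j ^ 2 * (∑ i, v j i * g i) ^ 2) ∧
      ∑ j, β j ^ 2 = L 1 := by
  set M : Matrix (Fin n) (Fin n) ℝ := fun a b => L (X a * X b) with hM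
  have hquad : ∀ g : Fin n → ℝ, L (coordForm g ^ 2) = ∑ a, ∑ b, g a * g b * M a b := by
    intro g
    rw [coordForm_sq, map_sum, Fintype.sum_prod_type]
    simp [hM]
  have hpsd : M.PosSemidef := by
    refine .of_dotProduct_mulVec_nonneg ?_ fun x => ?_
    · ext a b
      change L (X b * X a) = L (X a * X b)
      rw [mul_comm]
    · have h1 := h.map_sq_nonneg (coordForm x) (totalDegree_coordForm_le x)
      rw [hquad] at h1
      convert! h1 using 1
      simp only [dotProduct, Matrix.mulVec, Finset.mul_sum, star_trivial]
      exact Finset.sum_congr rfl fun a _ => Finset.sum_congr rfl fun b _ => by ring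
  obtain ⟨N, w, hw⟩ := Matrix.posSemidef_iff_eq_sum_vecMulVec.mp hpsd
  have hMab : ∀ a b, M a b = ∑ j, w j a * w j b := by
    intro a b
    rw [hw]
    simp [Matrix.sum_apply, Matrix.vecMulVec_apply]
  obtain ⟨q, hq⟩ : ∃ q : Fin N → ℝ, ∀ j, q j = ∑ i, w j i ^ 2 := ⟨_, fun _ => rfl⟩
  have hq0 : ∀ j, 0 ≤ q j := fun j => hq j ▸ Finset.sum_nonneg fun i _ => sq_nonneg _
  have hβ : ∀ j, Real.sqrt (q j) ^ 2 = q j := fun j => Real.sq_sqrt (hq0 j)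
  -- β_j is the length of w_j and v_j its direction. If w_j = 0, division by zero makes v_j = 0,
  -- which is why only ‖v_j‖ ≤ 1 is claimed.
  refine ⟨N, fun j => Real.sqrt (q j), fun j i => w j i / Real.sqrt (q j), ?_, ?_, ?_⟩
  · intro j
    simp only [div_pow, hβ, ← Finset.sum_div, ← hq]
    exact div_self_le_one _
  · intro g
    rw [hquad]
    have h1 : ∀ j, Real.sqrt (q j) ^ 2 * (∑ i, w j i / Real.sqrt (q j) * g i) ^ 2
        = (∑ i, w j i * g i) ^ 2 := by
      intro j
      simp only [div_mul_eq_mul_div, ← Finset.sum_div, div_pow, hβ]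
      rcases eq_or_ne (q j) 0 with h0 | h0
      · have : ∀ i, w j i = 0 := fun i => by
          have := (Finset.sum_eq_zero_iff_of_nonneg (fun i _ => sq_nonneg (w j i))).mp (hq j ▸ h0) i
            (Finset.mem_univ i)
          exact pow_eq_zero_iff two_ne_zero |>.mp this
        simp [this]
      · field_simp
    simp only [h1]
    simp only [hMab, sq, Finset.sum_mul, Finset.mul_sum]
    rw [Finset.sum_comm]
    refine (Finset.sum_congr rfl fun b _ => Finset.sum_comm).trans ?_
    rw [Finset.sum_comm]
    refine Finset.sum_congr rfl fun j _ =>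
      Finset.sum_congr rfl fun b _ => Finset.sum_congr rfl fun a _ => by ring
  -- The sum of the β_j² is the trace of `M`, that is L‖u‖², which the sphere constraint turns into
  -- L 1.
  · have h1 := h.sphere 1 (by simp)
    rw [mul_one, normSqPoly, map_sum] at h1
    rw [← h1]
    simp only [hβ]
    simp only [hq]
    rw [Finset.sum_comm]
    refine Finset.sum_congr rfl fun a _ => ?_
    have := hMab a a
    simp only [hM] at this
    simp only [sq, this]

theorem IsSphericalPositive.lintegral_coordForm_sq_le {L : MvPolynomial (Fin n) ℝ →ₗ[ℝ] ℝ}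
    (h : IsSphericalPositive 1 L) {t : Fin n → ℝ} {s : ℝ} (ht : ∑ i, t i ^ 2 = s) :
    ∫⁻ g, ENNReal.ofReal (shiftDensity t g ^ 2 * L (coordForm g ^ 2) ^ 2) ∂(gaussianVec n)
      ≤ ENNReal.ofReal (secondMomentConst s * L 1 ^ 2) := by
  obtain ⟨N, β, v, hv, hL, h1⟩ := h.exists_sum_sq
  simp only [hL, ← h1]
  exact lintegral_shiftDensity_sq_mul_sq_le ht β v hv

/-- For a unit vector c, ‖u‖² − ⟨c, u⟩² is the sum of the squares of the coordinates of the
component orthogonal to c. -/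
theorem IsSphericalPositive.map_coordForm_sq_le {L : MvPolynomial (Fin n) ℝ →ₗ[ℝ] ℝ}
    (h : IsSphericalPositive 1 L) {c : Fin n → ℝ} (hc : ∑ i, c i ^ 2 = 1) :
    L (coordForm c ^ 2) ≤ L 1 := by
  have h1 := h.sphere 1 (by simp)
  rw [mul_one] at h1
  have h2 := congrArg L (sum_perpForm_sq hc)
  rw [map_sum, map_sub, h1] at h2
  have h3 : 0 ≤ ∑ a, L (perpForm c a ^ 2) :=
    Finset.sum_nonneg fun a _ => h.map_sq_nonneg _ (totalDegree_perpForm_le c a)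
  linarith

/-- Base case of the second-moment induction. Cauchy–Schwarz and AM–GM bound the integrand by half
of (L⟨g, u⟩²)² plus half of (L 1)², times the squared density. -/
theorem IsSphericalPositive.lintegral_coordForm_mul_le {L : MvPolynomial (Fin n) ℝ →ₗ[ℝ] ℝ}
    (h : IsSphericalPositive 1 L) {t : Fin n → ℝ} {s : ℝ} (ht : ∑ i, t i ^ 2 = s)
    {c : Fin n → ℝ} (hc : ∑ i, c i ^ 2 = 1) :
    ∫⁻ g, ENNReal.ofReal (shiftDensity t g ^ 2 * L (coordForm g * coordForm c) ^ 2)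
        ∂(gaussianVec n)
      ≤ ENNReal.ofReal (secondMomentConst s * L 1 ^ 2) := by
  have h1 := h.map_coordForm_sq_le hc
  have h0 := h.map_sq_nonneg _ (totalDegree_coordForm_le c)
  have hb : ∀ g, shiftDensity t g ^ 2 * L (coordForm g * coordForm c) ^ 2
      ≤ 1 / 2 * (shiftDensity t g ^ 2 * L (coordForm g ^ 2) ^ 2)
        + 1 / 2 * L 1 ^ 2 * shiftDensity t g ^ 2 := by
    intro g
    have h2 := h.cauchy_schwarz (totalDegree_coordForm_le g) (totalDegree_coordForm_le c)
    have h3 : L (coordForm g * coordForm c) ^ 2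
        ≤ 1 / 2 * L (coordForm g ^ 2) ^ 2 + 1 / 2 * L 1 ^ 2 := by
      nlinarith [sq_nonneg (L (coordForm g ^ 2) - L (coordForm c ^ 2))]
    nlinarith [mul_le_mul_of_nonneg_left h3 (sq_nonneg (shiftDensity t g))]
  refine (lintegral_mono fun g => ENNReal.ofReal_le_ofReal (hb g)).trans ?_
  have hm : Measurable fun g => ENNReal.ofReal (1 / 2 * L 1 ^ 2 * shiftDensity t g ^ 2) := by
    have := (continuous_shiftDensity t).measurable
    fun_prop
  have hadd : ∀ g, ENNReal.ofReal (1 / 2 * (shiftDensity t g ^ 2 * L (coordForm g ^ 2) ^ 2)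
        + 1 / 2 * L 1 ^ 2 * shiftDensity t g ^ 2)
      = ENNReal.ofReal (1 / 2 * (shiftDensity t g ^ 2 * L (coordForm g ^ 2) ^ 2))
        + ENNReal.ofReal (1 / 2 * L 1 ^ 2 * shiftDensity t g ^ 2) :=
    fun g => ENNReal.ofReal_add (by positivity) (by positivity)
  simp only [hadd]
  rw [lintegral_add_right _ hm]
  simp only [ENNReal.ofReal_mul (by positivity : (0 : ℝ) ≤ 1 / 2 * L 1 ^ 2),
    ENNReal.ofReal_mul (by positivity : (0 : ℝ) ≤ 1 / 2)]
  rw [lintegral_const_mul' _ _ (by simp), lintegral_const_mul' _ _ (by finiteness)]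
  refine (add_le_add (mul_le_mul_right (h.lintegral_coordForm_sq_le ht) _)
    (mul_le_mul_right (lintegral_shiftDensity_sq_le ht) _)).trans ?_
  have hC : 0 ≤ secondMomentConst s := by
    unfold secondMomentConst
    positivity
  simp only [← ENNReal.ofReal_mul (by positivity : (0 : ℝ) ≤ 1 / 2)]
  rw [← ENNReal.ofReal_mul (by positivity), ← ENNReal.ofReal_add (by positivity) (by positivity)]
  refine ENNReal.ofReal_le_ofReal (le_of_eq ?_)
  ring

end Functional

/-! ### Moments of the unnormalized sample. -/

/-- The law of `M` independent standard Gaussian vectors in `ℝⁿ`. -/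
noncomputable def gaussianVecs (M n : ℕ) : Measure (Fin M → Fin n → ℝ) :=
  Measure.pi fun _ => gaussianVec n

instance (M n : ℕ) : IsProbabilityMeasure (gaussianVecs M n) := by
  unfold gaussianVecs
  infer_instance

/-- The product of the shift densities of several vectors. -/
noncomputable def shiftDensities {M n : ℕ} (t : Fin n → ℝ) (g : Fin M → Fin n → ℝ) : ℝ :=
  ∏ j, shiftDensity t (g j)

section Moments

open MvPolynomial

variable {n : ℕ}

theorem shiftDensities_pos {M : ℕ} (t : Fin n → ℝ) (g : Fin M → Fin n → ℝ) :
    0 < shiftDensities t g :=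
  Finset.prod_pos fun _ _ => shiftDensity_pos _ _

theorem continuous_shiftDensities {M : ℕ} (t : Fin n → ℝ) :
    Continuous (shiftDensities (M := M) t) := by
  unfold shiftDensities
  exact continuous_finsetProd _ fun j _ => (continuous_shiftDensity t).comp (continuous_apply j)

/-- `R` is the mean of the random polynomial `P g`, where `g` is a standard Gaussian vector shifted
by `t`. -/
def HasShiftMean (t : Fin n → ℝ) (P : (Fin n → ℝ) → MvPolynomial (Fin n) ℝ)
    (R : MvPolynomial (Fin n) ℝ) : Prop :=
  ∃ (ι : Type) (_ : Fintype ι) (f : ι → (Fin n → ℝ) → ℝ) (Q : ι → MvPolynomial (Fin n) ℝ),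
    (∀ i, Continuous (f i)) ∧
    (∀ i, Integrable (fun g => shiftDensity t g * f i g) (gaussianVec n)) ∧
    (∀ g, P g = ∑ i, f i g • Q i) ∧
    R = ∑ i, (∫ g, shiftDensity t g * f i g ∂(gaussianVec n)) • Q i

theorem hasShiftMean_const (t : Fin n → ℝ) (P : MvPolynomial (Fin n) ℝ) :
    HasShiftMean t (fun _ => P) P :=
  ⟨Unit, inferInstance, fun _ _ => 1, fun _ => P, fun _ => continuous_const,
    fun _ => by simpa using integrable_shiftDensity t, fun _ => by simp,
    by simp [integral_shiftDensity]⟩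

theorem hasShiftMean_coordForm_mul (t : Fin n → ℝ) (P : MvPolynomial (Fin n) ℝ) :
    HasShiftMean t (fun g => coordForm g * P) (coordForm t * P) := by
  refine ⟨Fin n, inferInstance, fun i g => g i, fun i => X i * P, fun i => continuous_apply i,
    integrable_shiftDensity_mul_apply t, fun g => ?_, ?_⟩
  · simp only [coordForm_eq_sum_smul, Finset.sum_mul, smul_mul_assoc]
  · rw [coordForm_eq_sum_smul, Finset.sum_mul]
    simp only [smul_mul_assoc, integral_shiftDensity_mul_apply]

/-- The second moments of the shifted vector are t_a t_b + δ_ab; the identity covariance contributes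
‖u‖², which later becomes the constant 1 in y. -/
theorem hasShiftMean_coordForm_sq (t : Fin n → ℝ) :
    HasShiftMean t (fun g => coordForm g ^ 2) (coordForm t ^ 2 + normSqPoly n) := by
  refine ⟨Fin n × Fin n, inferInstance, fun p g => g p.1 * g p.2, fun p => X p.1 * X p.2,
    fun p => by fun_prop, fun p => integrable_shiftDensity_mul_mul t p.1 p.2,
    fun g => coordForm_sq g, ?_⟩
  simp only [integral_shiftDensity_mul_mul, add_smul, Finset.sum_add_distrib, ← coordForm_sq]
  rw [Fintype.sum_prod_type]
  simp [normSqPoly, sq]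

/-- The mean of a linear functional of a product of independent random polynomials. -/
theorem integral_shiftDensities_mul {M : ℕ} (L : MvPolynomial (Fin n) ℝ →ₗ[ℝ] ℝ)
    {t : Fin n → ℝ} {P : Fin M → (Fin n → ℝ) → MvPolynomial (Fin n) ℝ}
    {R : Fin M → MvPolynomial (Fin n) ℝ} (h : ∀ j, HasShiftMean t (P j) (R j)) :
    Continuous (fun g : Fin M → Fin n → ℝ => L (∏ j, P j (g j))) ∧
    Integrable (fun g => shiftDensities t g * L (∏ j, P j (g j))) (gaussianVecs M n) ∧
    ∫ g, shiftDensities t g * L (∏ j, P j (g j)) ∂(gaussianVecs M n) = L (∏ j, R j) := by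
  choose ι hι f Q hf hint hP hR using h
  -- As each factor is a finite sum of scalar functions times fixed polynomials, expanding the
  -- product and applying L leaves products of functions of separate vectors, whose integrals factor
  -- by independence.
  have h1 : ∀ g : Fin M → Fin n → ℝ, L (∏ j, P j (g j))
      = ∑ p : ∀ j, ι j, (∏ j, f j (p j) (g j)) * L (∏ j, Q j (p j)) := by
    intro g
    simp only [hP, Finset.prod_univ_sum, Fintype.piFinset_univ, map_sum]
    refine Finset.sum_congr rfl fun p _ => ?_
    rw [Finset.prod_smul, map_smul, smul_eq_mul]
  have h2 : ∀ g : Fin M → Fin n → ℝ, shiftDensities t g * L (∏ j, P j (g j))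
      = ∑ p : ∀ j, ι j, (∏ j, shiftDensity t (g j) * f j (p j) (g j))
        * L (∏ j, Q j (p j)) := by
    intro g
    rw [h1, Finset.mul_sum]
    refine Finset.sum_congr rfl fun p _ => ?_
    rw [Finset.prod_mul_distrib, shiftDensities, mul_assoc]
  have h3 : ∀ p : ∀ j, ι j, Integrable (fun g : Fin M → Fin n → ℝ =>
      (∏ j, shiftDensity t (g j) * f j (p j) (g j)) * L (∏ j, Q j (p j))) (gaussianVecs M n) :=
    fun p => (Integrable.fintype_prod (f := fun j x => shiftDensity t x * f j (p j) x)
      fun j => hint j (p j)).mul_const _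
  refine ⟨?_, ?_, ?_⟩
  · simp only [h1]
    refine continuous_finsetSum _ fun p _ => Continuous.mul ?_ continuous_const
    exact continuous_finsetProd _ fun j _ => (hf j (p j)).comp (continuous_apply j)
  · simp only [h2]
    exact integrable_finsetSum _ fun p _ => h3 p
  · simp only [h2]
    rw [integral_finsetSum _ fun p _ => h3 p]
    simp only [integral_mul_const, hR, Finset.prod_univ_sum, Fintype.piFinset_univ, map_sum]
    refine Finset.sum_congr rfl fun p _ => ?_
    rw [Finset.prod_smul, map_smul, smul_eq_mul]
    congr 1
    exact integral_fintype_prod_eq_prod (fun j x => shiftDensity t x * f j (p j) x)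

/-- The reweighting polynomial, the product of the squares of the first `m` linear forms. -/
noncomputable def weightPoly {m : ℕ} (g : Fin (m + 1) → Fin n → ℝ) : MvPolynomial (Fin n) ℝ :=
  ∏ j : Fin m, coordForm (g j.castSucc) ^ 2

theorem integral_shiftDensities_mul_weightPoly {m : ℕ} (L : MvPolynomial (Fin n) ℝ →ₗ[ℝ] ℝ)
    {t : Fin n → ℝ} {P : (Fin n → ℝ) → MvPolynomial (Fin n) ℝ}
    {R : MvPolynomial (Fin n) ℝ} (h : HasShiftMean t P R) :
    Continuous (fun g : Fin (m + 1) → Fin n → ℝ => L (weightPoly g * P (g (Fin.last m)))) ∧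
    Integrable (fun g => shiftDensities t g * L (weightPoly g * P (g (Fin.last m))))
      (gaussianVecs (m + 1) n) ∧
    ∫ g, shiftDensities t g * L (weightPoly g * P (g (Fin.last m))) ∂(gaussianVecs (m + 1) n)
      = L ((coordForm t ^ 2 + normSqPoly n) ^ m * R) := by
  have := integral_shiftDensities_mul L (t := t)
    (P := Fin.snoc (α := fun _ => (Fin n → ℝ) → MvPolynomial (Fin n) ℝ)
      (fun _ : Fin m => fun g => coordForm g ^ 2) P)
    (R := Fin.snoc (α := fun _ => MvPolynomial (Fin n) ℝ)
      (fun _ : Fin m => coordForm t ^ 2 + normSqPoly n) R)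
    (fun j => by
      induction j using Fin.lastCases with
      | last => simpa using h
      | cast j => simpa using hasShiftMean_coordForm_sq t)
  simp only [Fin.prod_univ_castSucc, Fin.snoc_castSucc, Fin.snoc_last, Finset.prod_const,
    Finset.card_univ, Fintype.card_fin] at this
  exact this

theorem lintegral_gaussianVecs_succ {M : ℕ} {F : (Fin (M + 1) → Fin n → ℝ) → ENNReal}
    (hF : Measurable F) :
    ∫⁻ g, F g ∂(gaussianVecs (M + 1) n)
      = ∫⁻ x, ∫⁻ g, F (Fin.cons x g) ∂(gaussianVecs M n) ∂(gaussianVec n) := by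
  have h := (measurePreserving_piFinSuccAbove (fun _ : Fin (M + 1) => gaussianVec n) 0).symm
  unfold gaussianVecs
  rw [← h.lintegral_comp hF, lintegral_prod]
  · simp only [MeasurableEquiv.piFinSuccAbove_symm_apply, Fin.insertNthEquiv_zero]
    rfl
  · exact (hF.comp h.measurable).aemeasurable

theorem lintegral_gaussianVecs_one {F : (Fin 1 → Fin n → ℝ) → ENNReal} (hF : Measurable F) :
    ∫⁻ g, F g ∂(gaussianVecs 1 n) = ∫⁻ x, F (fun _ => x) ∂(gaussianVec n) := by
  rw [lintegral_gaussianVecs_succ hF]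
  refine lintegral_congr fun x => ?_
  have h : ∀ g : Fin 0 → Fin n → ℝ, (Fin.cons x g : Fin 1 → Fin n → ℝ) = fun _ => x := by
    intro g
    ext j
    rw [Fin.fin_one_eq_zero j]
    rfl
  simp [h]

theorem weightPoly_cons {m : ℕ} (x : Fin n → ℝ) (g : Fin (m + 1) → Fin n → ℝ) :
    weightPoly (Fin.cons x g : Fin (m + 1 + 1) → Fin n → ℝ) = coordForm x ^ 2 * weightPoly g := by
  simp only [weightPoly]
  rw [Fin.prod_univ_succ]
  simp only [Fin.castSucc_zero, Fin.cons_zero, ← Fin.succ_castSucc, Fin.cons_succ]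

theorem shiftDensities_cons {M : ℕ} (t x : Fin n → ℝ) (g : Fin M → Fin n → ℝ) :
    shiftDensities t (Fin.cons x g : Fin (M + 1) → Fin n → ℝ)
      = shiftDensity t x * shiftDensities t g := by
  simp only [shiftDensities]
  rw [Fin.prod_univ_succ]
  simp only [Fin.cons_zero, Fin.cons_succ]

theorem measurable_ofReal_shiftDensities_sq_mul {m : ℕ} (L : MvPolynomial (Fin n) ℝ →ₗ[ℝ] ℝ)
    (t c : Fin n → ℝ) : Measurable fun g : Fin (m + 1) → Fin n → ℝ =>
      ENNReal.ofReal (shiftDensities t g ^ 2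
        * L (weightPoly g * (coordForm (g (Fin.last m)) * coordForm c)) ^ 2) := by
  have h1 : Measurable fun g : Fin (m + 1) → Fin n → ℝ =>
      L (weightPoly g * (coordForm (g (Fin.last m)) * coordForm c)) :=
    (integral_shiftDensities_mul_weightPoly (m := m) L
    (hasShiftMean_coordForm_mul t (coordForm c))).1.measurable
  have h2 := (continuous_shiftDensities (M := m + 1) t).measurable
  exact ((h2.pow_const 2).mul (h1.pow_const 2)).ennreal_ofReal

/-- The second moment of the correlation of the sample with `c`. -/
theorem lintegral_shiftDensities_sq_le {t : Fin n → ℝ} {s : ℝ} (ht : ∑ i, t i ^ 2 = s)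
    {c : Fin n → ℝ} (hc : ∑ i, c i ^ 2 = 1) {m : ℕ} :
    ∀ L : MvPolynomial (Fin n) ℝ →ₗ[ℝ] ℝ, IsSphericalPositive (m + 1) L →
    ∫⁻ g, ENNReal.ofReal (shiftDensities t g ^ 2
        * L (weightPoly g * (coordForm (g (Fin.last m)) * coordForm c)) ^ 2)
        ∂(gaussianVecs (m + 1) n)
      ≤ ENNReal.ofReal (secondMomentConst s ^ (m + 1) * L 1 ^ 2) := by
  have hC : 0 ≤ secondMomentConst s := by
    unfold secondMomentConst
    positivity
  induction m with
  | zero =>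
    intro L hL
    rw [lintegral_gaussianVecs_one (measurable_ofReal_shiftDensities_sq_mul L t c)]
    simpa [shiftDensities, weightPoly] using hL.lintegral_coordForm_mul_le ht hc
  | succ m ih =>
    intro L hL
    rw [lintegral_gaussianVecs_succ (measurable_ofReal_shiftDensities_sq_mul L t c)]
    simp only [shiftDensities_cons, weightPoly_cons, ← Fin.succ_last, Fin.cons_succ]
    -- Fix the first vector x and absorb ⟨x, u⟩² into the functional, at the cost of one degree of
    -- positivity. The induction hypothesis leaves the square of the new functional at 1, which is
    -- L⟨x, u⟩²; averaging over x then costs one more constant.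
    have h1 : ∀ x, ∫⁻ g, ENNReal.ofReal ((shiftDensity t x * shiftDensities t g) ^ 2
        * L (coordForm x ^ 2 * weightPoly g * (coordForm (g (Fin.last m)) * coordForm c)) ^ 2)
        ∂(gaussianVecs (m + 1) n)
        ≤ ENNReal.ofReal (secondMomentConst s ^ (m + 1))
          * ENNReal.ofReal (shiftDensity t x ^ 2 * L (coordForm x ^ 2) ^ 2) := by
      intro x
      have h2 := ih _ (hL.mul_sq (totalDegree_coordForm_le x))
      simp only [LinearMap.comp_apply, LinearMap.mulLeft_apply, mul_one] at h2
      have h3 : ∀ g : Fin (m + 1) → Fin n → ℝ,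
          ENNReal.ofReal ((shiftDensity t x * shiftDensities t g) ^ 2
            * L (coordForm x ^ 2 * weightPoly g
              * (coordForm (g (Fin.last m)) * coordForm c)) ^ 2)
          = ENNReal.ofReal (shiftDensity t x ^ 2) * ENNReal.ofReal (shiftDensities t g ^ 2
            * L (coordForm x ^ 2 * (weightPoly g
              * (coordForm (g (Fin.last m)) * coordForm c))) ^ 2) := by
        intro g
        rw [← ENNReal.ofReal_mul (sq_nonneg _), mul_pow, mul_assoc, mul_assoc (coordForm x ^ 2)]
      simp only [h3]
      rw [lintegral_const_mul' _ _ ENNReal.ofReal_ne_top]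
      refine (mul_le_mul_right h2 _).trans (le_of_eq ?_)
      rw [← ENNReal.ofReal_mul (sq_nonneg _), ← ENNReal.ofReal_mul (by positivity)]
      congr 1
      ring
    refine (lintegral_mono h1).trans ?_
    rw [lintegral_const_mul' _ _ ENNReal.ofReal_ne_top]
    refine (mul_le_mul_right ((hL.mono (by omega)).lintegral_coordForm_sq_le ht) _).trans
      (le_of_eq ?_)
    rw [← ENNReal.ofReal_mul (by positivity)]
    congr 1
    ring

end Moments

/-! ### Lower bound for the probability of a good sample. -/

section Success

open MvPolynomial

variable {n m : ℕ}

theorem weightPoly_eq_sq (g : Fin (m + 1) → Fin n → ℝ) :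
    weightPoly g = (∏ j : Fin m, coordForm (g j.castSucc)) ^ 2 := by
  rw [weightPoly, Finset.prod_pow]

theorem totalDegree_prod_mul_le (g : Fin (m + 1) → Fin n → ℝ) {P : MvPolynomial (Fin n) ℝ}
    (hP : P.totalDegree ≤ 1) :
    ((∏ j : Fin m, coordForm (g j.castSucc)) * P).totalDegree ≤ m + 1 := by
  have := totalDegree_prod_coordForm_le Finset.univ (fun j : Fin m => g j.castSucc)
  rw [Finset.card_univ, Fintype.card_fin] at this
  exact totalDegree_mul_le_add this hP

/-- The squared length of the component orthogonal to `c` of the sample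
`L (weightPoly g * ⟨g_m, u⟩ * u)`. -/
noncomputable def perpSq (L : MvPolynomial (Fin n) ℝ →ₗ[ℝ] ℝ) (c : Fin n → ℝ)
    (g : Fin (m + 1) → Fin n → ℝ) : ℝ :=
  ∑ a, L (weightPoly g * (coordForm (g (Fin.last m)) * perpForm c a)) ^ 2

/-- The component along `c` of the sample. -/
noncomputable def alongComp (L : MvPolynomial (Fin n) ℝ →ₗ[ℝ] ℝ) (c : Fin n → ℝ)
    (g : Fin (m + 1) → Fin n → ℝ) : ℝ :=
  L (weightPoly g * (coordForm (g (Fin.last m)) * coordForm c))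

variable {L : MvPolynomial (Fin n) ℝ →ₗ[ℝ] ℝ}

theorem IsSphericalPositive.map_weightPoly_mul_sq_nonneg (h : IsSphericalPositive (m + 1) L)
    (g : Fin (m + 1) → Fin n → ℝ) {P : MvPolynomial (Fin n) ℝ} (hP : P.totalDegree ≤ 1) :
    0 ≤ L (weightPoly g * P ^ 2) := by
  rw [weightPoly_eq_sq, ← mul_pow]
  exact h.map_sq_nonneg _ (totalDegree_prod_mul_le g hP)

/-- W is the square of one polynomial, so Cauchy–Schwarz applies to each coordinate of the
orthogonal component, and these bounds add up. -/
theorem IsSphericalPositive.perpSq_le (h : IsSphericalPositive (m + 1) L) {c : Fin n → ℝ}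
    (hc : ∑ i, c i ^ 2 = 1) (g : Fin (m + 1) → Fin n → ℝ) :
    perpSq L c g ≤ L (weightPoly g * (normSqPoly n - coordForm c ^ 2))
      * L (weightPoly g * coordForm (g (Fin.last m)) ^ 2) := by
  rw [← sum_perpForm_sq hc, Finset.mul_sum, map_sum, Finset.sum_mul]
  refine Finset.sum_le_sum fun a _ => ?_
  have := h.cauchy_schwarz (totalDegree_prod_mul_le g (totalDegree_perpForm_le c a))
    (totalDegree_prod_mul_le g (totalDegree_coordForm_le (g (Fin.last m))))
  rw [mul_pow, mul_pow, ← weightPoly_eq_sq] at this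
  refine le_trans (le_of_eq ?_) this
  rw [weightPoly_eq_sq]
  ring_nf

theorem IsSphericalPositive.map_weightPoly_mul_perp_nonneg (h : IsSphericalPositive (m + 1) L)
    {c : Fin n → ℝ} (hc : ∑ i, c i ^ 2 = 1) (g : Fin (m + 1) → Fin n → ℝ) :
    0 ≤ L (weightPoly g * (normSqPoly n - coordForm c ^ 2)) := by
  rw [← sum_perpForm_sq hc, Finset.mul_sum, map_sum]
  exact Finset.sum_nonneg fun a _ => h.map_weightPoly_mul_sq_nonneg g (totalDegree_perpForm_le c a)

theorem coordForm_smul (τ : ℝ) (c : Fin n → ℝ) :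
    coordForm (fun i => τ * c i) = C τ * coordForm c := by
  simp only [coordForm, Finset.mul_sum, C_mul, mul_assoc]

/-- A bound of a function by its restriction to the good set and quantities of known mean. -/
theorem alongComp_le_indicator {y p z S κ lam δ ρ : ℝ} (hz : 0 ≤ z) (hS : 0 ≤ S) (hκ : 0 < κ)
    (hl : 0 < lam) (hδ : 0 < δ) (hρ : 0 < ρ) (hp : p ≤ z * S) :
    ρ * y ≤ δ / 2 * (ρ ^ 2 * y ^ 2) + (1 / (2 * δ)) * (if 0 < y ∧ p ≤ κ * y ^ 2 then 1 else 0)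
      + (lam / 2 * (ρ * z) + 1 / (2 * lam * κ) * (ρ * S)) := by
  have h0 : 0 ≤ lam / 2 * (ρ * z) + 1 / (2 * lam * κ) * (ρ * S) := by positivity
  split_ifs with hg
  -- On the good set, AM–GM replaces Cauchy–Schwarz between ρy and the indicator; no density
  -- multiplies the indicator, so its integral is the unshifted probability.
  · have : ρ * y ≤ δ / 2 * (ρ ^ 2 * y ^ 2) + 1 / (2 * δ) * 1 := by
      have h1 : δ / 2 * (ρ ^ 2 * y ^ 2) + 1 / (2 * δ) * 1 - ρ * y
          = (δ * (ρ * y) - 1) ^ 2 / (2 * δ) := by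
        field_simp
        ring
      have : 0 ≤ (δ * (ρ * y) - 1) ^ 2 / (2 * δ) := by positivity
      linarith
    linarith
  · rw [mul_zero, add_zero]
    have h2 : 0 ≤ δ / 2 * (ρ ^ 2 * y ^ 2) := by positivity
    suffices ρ * y ≤ lam / 2 * (ρ * z) + 1 / (2 * lam * κ) * (ρ * S) by linarith
    by_cases hy : 0 < y
    -- At a bad point with y > 0, y² < zS/κ; AM–GM with parameter `lam` makes the bound linear in z
    -- and S, whose means are known.
    · have h3 : κ * y ^ 2 < p := by
        by_contra hcon
        exact hg ⟨hy, not_lt.mp hcon⟩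
      have h4 : y ≤ lam / 2 * z + 1 / (2 * lam * κ) * S := by
        refine abs_le_of_sq_le_sq' (a := y) ?_ (by positivity) |>.2
        have h5 : (lam / 2 * z + 1 / (2 * lam * κ) * S) ^ 2 - z * S / κ
            = (lam / 2 * z - 1 / (2 * lam * κ) * S) ^ 2 := by
          field_simp
          ring
        have h6 : y ^ 2 ≤ z * S / κ := by
          rw [le_div_iff₀ hκ]
          linarith
        nlinarith [sq_nonneg (lam / 2 * z - 1 / (2 * lam * κ) * S)]
      calc ρ * y ≤ ρ * (lam / 2 * z + 1 / (2 * lam * κ) * S) := by gcongr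
        _ = _ := by ring
    · exact (mul_nonpos_of_nonneg_of_nonpos hρ.le (not_lt.mp hy)).trans h0

theorem continuous_alongComp (L : MvPolynomial (Fin n) ℝ →ₗ[ℝ] ℝ) (c : Fin n → ℝ) :
    Continuous (alongComp (m := m) L c) :=
  (integral_shiftDensities_mul_weightPoly (m := m) L
    (hasShiftMean_coordForm_mul 0 (coordForm c))).1

theorem continuous_perpSq (L : MvPolynomial (Fin n) ℝ →ₗ[ℝ] ℝ) (c : Fin n → ℝ) :
    Continuous (perpSq (m := m) L c) :=
  continuous_finsetSum _ fun a _ => ((integral_shiftDensities_mul_weightPoly (m := m) L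
    (hasShiftMean_coordForm_mul 0 (perpForm c a))).1).pow 2

theorem measurableSet_good (L : MvPolynomial (Fin n) ℝ →ₗ[ℝ] ℝ) (c : Fin n → ℝ) (κ : ℝ) :
    MeasurableSet {g : Fin (m + 1) → Fin n → ℝ |
      0 < alongComp L c g ∧ perpSq L c g ≤ κ * alongComp L c g ^ 2} :=
  (measurableSet_lt measurable_const (continuous_alongComp L c).measurable).inter
    (measurableSet_le (continuous_perpSq L c).measurable
      (((continuous_alongComp L c).measurable.pow_const 2).const_mul κ))

theorem integral_linear_combination_four {α : Type*} [MeasurableSpace α] {μ : Measure α}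
    {f₁ f₂ f₃ f₄ : α → ℝ} (h₁ : Integrable f₁ μ) (h₂ : Integrable f₂ μ) (h₃ : Integrable f₃ μ)
    (h₄ : Integrable f₄ μ) (c₁ c₂ c₃ c₄ : ℝ) :
    Integrable (fun x => c₁ * f₁ x + c₂ * f₂ x + (c₃ * f₃ x + c₄ * f₄ x)) μ ∧
    ∫ x, c₁ * f₁ x + c₂ * f₂ x + (c₃ * f₃ x + c₄ * f₄ x) ∂μ
      = c₁ * ∫ x, f₁ x ∂μ + c₂ * ∫ x, f₂ x ∂μ + (c₃ * ∫ x, f₃ x ∂μ + c₄ * ∫ x, f₄ x ∂μ) := by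
  have i₁₂ : Integrable (fun x => c₁ * f₁ x + c₂ * f₂ x) μ :=
    (h₁.const_mul c₁).add (h₂.const_mul c₂)
  have i₃₄ : Integrable (fun x => c₃ * f₃ x + c₄ * f₄ x) μ :=
    (h₃.const_mul c₃).add (h₄.const_mul c₄)
  refine ⟨i₁₂.add i₃₄, ?_⟩
  rw [integral_add i₁₂ i₃₄, integral_add (h₁.const_mul c₁) (h₂.const_mul c₂),
    integral_add (h₃.const_mul c₃) (h₄.const_mul c₄), integral_const_mul, integral_const_mul,
    integral_const_mul, integral_const_mul]

/-- The main term is at least 3τa/4. The parameters `τ ^ 3 / 12` and `96 / τ ^ 2` make each of the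
last two terms at most τa/8, and δ = 1/(2B) makes the second-moment term at most 1/4. So τa/2 ≤ 1/4
+ Bq, and τa ≥ 1 leaves Bq ≥ 1/4. -/
theorem one_div_le_of_moment_bound {B τ a p I q : ℝ} (hB0 : 0 < B) (hτ : 0 < τ)
    (hτ2 : 12 ≤ τ ^ 2) (ha1 : 1 ≤ a) (hpa : (1 - 3 * (τ ^ 2)⁻¹) * a ≤ p) (hpa' : p ≤ a)
    (hI : I ≤ B)
    (hmono : τ * p ≤ 1 / (2 * B) / 2 * I + 1 / (2 * (1 / (2 * B))) * q
      + (τ ^ 3 / 12 / 2 * (a - p)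
        + 1 / (2 * (τ ^ 3 / 12) * (96 / τ ^ 2)) * (τ ^ 2 * p + a))) :
    1 / (4 * B) ≤ q := by
  have e1 : 1 / (2 * B) / 2 * I ≤ 1 / 4 := by
    calc _ ≤ 1 / (2 * B) / 2 * B := by gcongr
      _ = 1 / 4 := by field_simp; norm_num
  have e2 : 1 / (2 * (1 / (2 * B))) = B := by field_simp
  rw [e2] at hmono
  have e3 : τ ^ 3 / 12 / 2 * (a - p) ≤ τ * a / 8 := by
    calc τ ^ 3 / 12 / 2 * (a - p) ≤ τ ^ 3 / 12 / 2 * (3 * (τ ^ 2)⁻¹ * a) := by gcongr; linarith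
      _ = τ * a / 8 := by field_simp; norm_num
  have hτ1 : 1 ≤ τ := by nlinarith
  have e4 : 1 / (2 * (τ ^ 3 / 12) * (96 / τ ^ 2)) * (τ ^ 2 * p + a) ≤ τ * a / 8 := by
    have : τ ^ 2 * p + a ≤ τ ^ 2 * a + τ ^ 2 * a := by nlinarith
    calc 1 / (2 * (τ ^ 3 / 12) * (96 / τ ^ 2)) * (τ ^ 2 * p + a)
        ≤ 1 / (2 * (τ ^ 3 / 12) * (96 / τ ^ 2)) * (τ ^ 2 * a + τ ^ 2 * a) := by gcongr
      _ = τ * a / 8 := by field_simp; norm_num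
  have e5 : 3 * (τ ^ 2)⁻¹ ≤ 1 / 4 := by
    have : (τ ^ 2)⁻¹ ≤ 12⁻¹ := by gcongr
    linarith
  have e6 : 3 / 4 * a ≤ p := by nlinarith
  have e7 : τ * (3 / 4 * a) ≤ τ * p := mul_le_mul_of_nonneg_left e6 hτ.le
  have e8 : 1 ≤ τ * a := by nlinarith
  have e9 : 1 / 4 ≤ B * q := by linarith
  rw [div_le_iff₀ (by positivity)]
  linarith

/-- The sample is close to the direction `c` with probability at least `1 / (4 C ^ (m + 1))`. -/
theorem IsSphericalPositive.le_measureReal_good (h : IsSphericalPositive (m + 1) L) (h1 : L 1 = 1)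
    {c : Fin n → ℝ} (hc : ∑ i, c i ^ 2 = 1) {τ : ℝ} (hτ : 0 < τ) (hτ2 : 12 ≤ τ ^ 2)
    (hL : Real.exp (-(2 * (τ ^ 2)⁻¹)) ^ (m + 1) ≤ L (coordForm c ^ (2 * (m + 1)))) :
    1 / (4 * secondMomentConst (τ ^ 2) ^ (m + 1)) ≤ (gaussianVecs (m + 1) n).real
      {g | 0 < alongComp L c g ∧ perpSq L c g ≤ 96 / τ ^ 2 * alongComp L c g ^ 2} := by
  set t : Fin n → ℝ := fun i => τ * c i with ht
  have hts : ∑ i, t i ^ 2 = τ ^ 2 := by simp only [ht, mul_pow, ← Finset.mul_sum, hc, mul_one]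
  set B : ℝ := secondMomentConst (τ ^ 2) ^ (m + 1) with hB
  have hB0 : 0 < B := by
    rw [hB, secondMomentConst]
    positivity
  have hdeg : (normSqPoly n - coordForm c ^ 2).totalDegree ≤ 2 :=
    totalDegree_sub_le (totalDegree_normSqPoly_le n)
      (totalDegree_pow_le_mul (totalDegree_coordForm_le c) 2)
  have hy : coordForm t ^ 2 + normSqPoly n = C (τ ^ 2) * coordForm c ^ 2 + normSqPoly n := by
    rw [ht, coordForm_smul, mul_pow, C_pow]
  set a : ℝ := L ((C (τ ^ 2) * coordForm c ^ 2 + 1) ^ m) with ha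
  set p : ℝ := L ((C (τ ^ 2) * coordForm c ^ 2 + 1) ^ m * coordForm c ^ 2) with hp
  have ha1 : 1 ≤ a := h.one_le_map_pow h1 (sq_nonneg τ) c (by omega)
  have hpa : (1 - 3 * (τ ^ 2)⁻¹) * a ≤ p := by
    have := h.le_map_pow_mul_sq h1 (s := τ ^ 2) (by positivity) c hL
    refine le_trans (le_of_eq ?_) this
    ring
  -- Degree 2 for `Q` exactly exhausts the available degree 2(m + 1).
  have hred : ∀ Q : MvPolynomial (Fin n) ℝ, Q.totalDegree ≤ 2 →
      L ((coordForm t ^ 2 + normSqPoly n) ^ m * Q)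
        = L ((C (τ ^ 2) * coordForm c ^ 2 + 1) ^ m * Q) := by
    intro Q hQ
    rw [hy, mul_comm, h.map_mul_pow_eq _ c m Q (by omega), mul_comm]
  have hnorm : L ((C (τ ^ 2) * coordForm c ^ 2 + 1) ^ m * normSqPoly n) = a := by
    rw [mul_comm, h.sphere]
    have : (C (τ ^ 2) * coordForm c ^ 2 + 1).totalDegree ≤ 2 :=
      totalDegree_add_le ((totalDegree_mul_le_add (totalDegree_C_le _ 0)
        (totalDegree_pow_le_mul (totalDegree_coordForm_le c) 2))) (by simp)
    have := totalDegree_pow_le_mul this m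
    omega
  obtain ⟨-, hYi, hY⟩ := integral_shiftDensities_mul_weightPoly (m := m) L
    (hasShiftMean_coordForm_mul t (coordForm c))
  obtain ⟨-, hZi, hZ⟩ := integral_shiftDensities_mul_weightPoly (m := m) L
    (hasShiftMean_const t (normSqPoly n - coordForm c ^ 2))
  obtain ⟨-, hSi, hS⟩ := integral_shiftDensities_mul_weightPoly (m := m) L
    (hasShiftMean_coordForm_sq t)
  have hYv : L ((coordForm t ^ 2 + normSqPoly n) ^ m * (coordForm t * coordForm c)) = τ * p := by
    have h2 : (coordForm t ^ 2 + normSqPoly n) ^ m * (coordForm t * coordForm c)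
        = τ • ((coordForm t ^ 2 + normSqPoly n) ^ m * coordForm c ^ 2) := by
      rw [ht, coordForm_smul, smul_eq_C_mul]
      ring
    rw [h2, map_smul, smul_eq_mul, hred _ (totalDegree_pow_le_mul (totalDegree_coordForm_le c) 2)]
  have hZv : L ((coordForm t ^ 2 + normSqPoly n) ^ m * (normSqPoly n - coordForm c ^ 2))
      = a - p := by
    rw [hred _ hdeg, mul_sub, map_sub, hnorm]
  have hSv : L ((coordForm t ^ 2 + normSqPoly n) ^ m * (coordForm t ^ 2 + normSqPoly n))
      = τ ^ 2 * p + a := by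
    have hd : (coordForm t ^ 2 + normSqPoly n).totalDegree ≤ 2 :=
      totalDegree_add_le (totalDegree_pow_le_mul (totalDegree_coordForm_le t) 2)
        (totalDegree_normSqPoly_le n)
    rw [hred _ hd, hy, mul_add, map_add, hnorm, mul_left_comm, ← smul_eq_C_mul, map_smul,
      smul_eq_mul]
  rw [hYv] at hY
  rw [hZv] at hZ
  rw [hSv] at hS
  have hpa' : p ≤ a := by
    have : 0 ≤ a - p := hZ ▸ integral_nonneg fun g =>
      mul_nonneg (shiftDensities_pos t g).le (h.map_weightPoly_mul_perp_nonneg hc g)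
    linarith
  set G : Set (Fin (m + 1) → Fin n → ℝ) :=
    {g | 0 < alongComp L c g ∧ perpSq L c g ≤ 96 / τ ^ 2 * alongComp L c g ^ 2} with hG
  have hGm : MeasurableSet G := measurableSet_good L c _
  -- The bound on the Lebesgue integral supplies integrability as well as the value.
  have hsq : Integrable (fun g => shiftDensities t g ^ 2 * alongComp L c g ^ 2)
      (gaussianVecs (m + 1) n) ∧
      ∫ g, shiftDensities t g ^ 2 * alongComp L c g ^ 2 ∂(gaussianVecs (m + 1) n) ≤ B := by
    have h2 := lintegral_shiftDensities_sq_le hts hc L h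
    rw [h1, one_pow, mul_one] at h2
    have hm : Measurable fun g : Fin (m + 1) → Fin n → ℝ =>
        shiftDensities t g ^ 2 * alongComp L c g ^ 2 :=
      ((continuous_shiftDensities t).measurable.pow_const 2).mul
        ((continuous_alongComp L c).measurable.pow_const 2)
    have h0 : ∀ g : Fin (m + 1) → Fin n → ℝ,
        0 ≤ shiftDensities t g ^ 2 * alongComp L c g ^ 2 := fun g => by positivity
    refine ⟨⟨hm.aestronglyMeasurable, ?_⟩, ?_⟩
    · rw [hasFiniteIntegral_iff_ofReal (Filter.Eventually.of_forall h0)]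
      exact h2.trans_lt ENNReal.ofReal_lt_top
    · rw [integral_eq_lintegral_of_nonneg_ae (Filter.Eventually.of_forall h0)
        hm.aestronglyMeasurable]
      exact ENNReal.toReal_le_of_le_ofReal hB0.le h2
  have hindm : Integrable (G.indicator fun _ => (1 : ℝ)) (gaussianVecs (m + 1) n) :=
    (integrable_const 1).indicator hGm
  have hind : ∫ g, G.indicator (fun _ => (1 : ℝ)) g ∂(gaussianVecs (m + 1) n)
      = (gaussianVecs (m + 1) n).real G := by
    rw [integral_indicator_const _ hGm, smul_eq_mul, mul_one]
  set δ : ℝ := 1 / (2 * B) with hδ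
  have hδ0 : 0 < δ := by positivity
  set lam : ℝ := τ ^ 3 / 12 with hlam
  have hlam0 : 0 < lam := by positivity
  have hκ0 : 0 < 96 / τ ^ 2 := by positivity
  have hmono : ∫ g, shiftDensities t g
        * L (weightPoly g * (coordForm (g (Fin.last m)) * coordForm c)) ∂(gaussianVecs (m + 1) n)
      ≤ ∫ g, (δ / 2 * (shiftDensities t g ^ 2 * alongComp L c g ^ 2)
          + (1 / (2 * δ)) * G.indicator (fun _ => (1 : ℝ)) g
          + (lam / 2 * (shiftDensities t g
              * L (weightPoly g * (normSqPoly n - coordForm c ^ 2)))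
            + 1 / (2 * lam * (96 / τ ^ 2)) * (shiftDensities t g
              * L (weightPoly g * coordForm (g (Fin.last m)) ^ 2)))) ∂(gaussianVecs (m + 1) n) := by
    refine integral_mono hYi
      (integral_linear_combination_four hsq.1 hindm hZi hSi _ _ _ _).1 fun g => ?_
    have := alongComp_le_indicator (y := alongComp L c g) (h.map_weightPoly_mul_perp_nonneg hc g)
      (h.map_weightPoly_mul_sq_nonneg g (totalDegree_coordForm_le (g (Fin.last m)))) hκ0 hlam0 hδ0
      (shiftDensities_pos t g) (h.perpSq_le hc g)
    simp only [Set.indicator_apply, hG, Set.mem_ofPred_eq]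
    exact this
  rw [hY, (integral_linear_combination_four hsq.1 hindm hZi hSi _ _ _ _).2, hZ, hS, hind] at hmono
  exact one_div_le_of_moment_bound hB0 hτ hτ2 ha1 hpa hpa' hsq.2 hmono

end Success

/-! ### From the random number sequence to Gaussian vectors. -/

section Transfer

/-- The first `M` blocks of length `n` of a sequence. -/
def blocks (M n : ℕ) (ω : ℕ → ℝ) : Fin M → Fin n → ℝ := fun j i => ω (j * n + i)

theorem block_index_injective (M n : ℕ) :
    Function.Injective fun p : Fin M × Fin n => (p.1 : ℕ) * n + p.2 := by
  rintro ⟨j, i⟩ ⟨j', i'⟩ h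
  simp only at h
  have hn : 0 < n := i.pos
  have h1 := congrArg (· % n) h
  have h2 := congrArg (· / n) h
  simp only [mul_comm _ n, Nat.mul_add_mod, Nat.mod_eq_of_lt i.2, Nat.mod_eq_of_lt i'.2,
    Nat.mul_add_div hn, Nat.div_eq_of_lt i.2, Nat.div_eq_of_lt i'.2, add_zero] at h1 h2
  exact Prod.ext (Fin.ext h2) (Fin.ext h1)

/-- Distinct block positions read distinct terms of an independent sequence, so their joint law is a
product; currying groups it into vectors. -/
theorem measurePreserving_blocks (M n : ℕ) :
    MeasurePreserving (blocks M n) RealRAM.gaussianSeq (gaussianVecs M n) := by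
  have h1 : iIndepFun (fun (i : ℕ) (ω : ℕ → ℝ) => ω i) RealRAM.gaussianSeq :=
    iIndepFun_infinitePi (P := fun _ : ℕ => gaussianReal 0 1) (X := fun _ x => x)
      (fun _ => measurable_id)
  have h2 := h1.precomp (block_index_injective M n)
  have hp : IsProbabilityMeasure RealRAM.gaussianSeq := by
    unfold RealRAM.gaussianSeq
    infer_instance
  have h3 := (iIndepFun_iff_map_fun_eq_pi_map
    (fun p : Fin M × Fin n => (measurable_pi_apply ((p.1 : ℕ) * n + p.2)).aemeasurable)).mp h2
  have h4 : ∀ i : ℕ, RealRAM.gaussianSeq.map (fun ω => ω i) = gaussianReal 0 1 := fun i =>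
    Measure.infinitePi_map_eval (fun _ : ℕ => gaussianReal 0 1) i
  simp only [h4] at h3
  have h5 := Measure.infinitePi_map_curry (fun (_ : Fin M) (_ : Fin n) => gaussianReal 0 1)
  simp only [Measure.infinitePi_eq_pi] at h5
  have h6 : Measurable (blocks M n) := by
    unfold blocks
    fun_prop
  refine ⟨h6, ?_⟩
  unfold gaussianVecs gaussianVec
  rw [← h5, ← h3, Measure.map_map (MeasurableEquiv.measurable _) (by fun_prop)]
  rfl

end Transfer

/-! ### Running-time logic and subroutines of the machine. -/

namespace RealRAM

/-- Started in `s`, the program halts within `T` steps in a state that satisfies `Q`. -/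
def Halts (ω : ℕ → ℝ) (p : Program) (s : State) (T : ℕ) (Q : State → Prop) : Prop :=
  ∃ (s' : State) (t : ℕ), Exec ω p s s' t ∧ t ≤ T ∧ Q s'

variable {ω : ℕ → ℝ} {s : State}

theorem Halts.instr {i : Instr} {Q : State → Prop} (h : Q (i.run ω s)) :
    Halts ω (.instr i) s 1 Q :=
  ⟨_, 1, .instr i s, le_rfl, h⟩

theorem Halts.seq {p q : Program} {T T' : ℕ} {Q : State → Prop}
    (h : Halts ω p s T fun s' => Halts ω q s' T' Q) : Halts ω (.seq p q) s (T + T') Q := by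
  obtain ⟨s', t, h1, ht, s'', t', h2, ht', hQ⟩ := h
  exact ⟨s'', t + t', h1.seq h2, by omega, hQ⟩

theorem Halts.ite {b : Test} {p q : Program} {T : ℕ} {Q : State → Prop}
    (h1 : b.Holds s → Halts ω p s T Q) (h2 : ¬ b.Holds s → Halts ω q s T Q) :
    Halts ω (.ite b p q) s (T + 1) Q := by
  by_cases h : b.Holds s
  · obtain ⟨s', t, he, ht, hQ⟩ := h1 h
    exact ⟨s', t + 1, .ite_true h he, by omega, hQ⟩
  · obtain ⟨s', t, he, ht, hQ⟩ := h2 h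
    exact ⟨s', t + 1, .ite_false h he, by omega, hQ⟩

theorem Halts.mono {p : Program} {T T' : ℕ} {Q Q' : State → Prop} (h : Halts ω p s T Q)
    (hT : T ≤ T') (hQ : ∀ s', Q s' → Q' s') : Halts ω p s T' Q' := by
  obtain ⟨s', t, he, ht, h⟩ := h
  exact ⟨s', t, he, ht.trans hT, hQ _ h⟩

/-- `for N[i] = 0, …, N[b] - 1 do body`; integer register `1` has to hold the number `1`. -/
def forLoop (i b : ℕ) (body : Program) : Program :=
  .seq (.instr (.natConst i 0))
    (.while (.natLt i b) (.seq body (.instr (.natAdd i i 1))))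

/-- Induction on the number of remaining rounds. A round costs the body, one test and one increment;
the extra 2 pays for the initial assignment and the final failing test. -/
theorem Halts.forLoop {i b : ℕ} {body : Program} {B T : ℕ} {I : ℕ → State → Prop}
    (hI : ∀ j st, I j st → st.natReg i = j ∧ st.natReg b = B)
    (h0 : I 0 (s.setNat i 0))
    (hstep : ∀ j st, j < B → I j st → Halts ω body st T fun st' =>
      st'.natReg i = j ∧ st'.natReg 1 = 1 ∧ I (j + 1) (st'.setNat i (j + 1))) :
    Halts ω (RealRAM.forLoop i b body) s (B * (T + 2) + 2) (I B) := by
  have key : ∀ d j st, j + d = B → I j st →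
      Halts ω (.while (.natLt i b) (.seq body (.instr (.natAdd i i 1)))) st
        (d * (T + 2) + 1) (I B) := by
    intro d
    induction d with
    | zero =>
      intro j st hj hst
      obtain ⟨h1, h2⟩ := hI j st hst
      refine ⟨st, 1, .while_false ?_, by omega, ?_⟩
      · simp only [Test.Holds]
        omega
      · rwa [← hj, add_zero]
    | succ d ih =>
      intro j st hj hst
      obtain ⟨h1, h2⟩ := hI j st hst
      obtain ⟨st', t, he, ht, hi, hone, hst'⟩ := hstep j st (by omega) hst
      have hrun : (Instr.natAdd i i 1).run ω st' = st'.setNat i (j + 1) := by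
        simp only [Instr.run, hi, hone]
      obtain ⟨st'', t', he', ht', hQ⟩ := ih (j + 1) _ (by omega) hst'
      refine ⟨st'', (t + 1) + t' + 1, .while_true ?_ (he.seq (.instr _ _)) (hrun ▸ he'), ?_, hQ⟩
      · simp only [Test.Holds]
        omega
      · rw [Nat.succ_mul]
        omega
  have h := Halts.seq (ω := ω) (s := s) (Halts.instr (i := .natConst i 0) (key B 0 _ (by omega) h0))
  exact h.mono (by omega) fun _ h => h

/-- All integer registers except the temporary ones `4, 5, 6, 7` agree. -/
def SameRegs (s s' : State) : Prop := ∀ r, r < 4 ∨ 8 ≤ r → s'.natReg r = s.natReg r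

theorem SameRegs.trans {s s' s'' : State} (h : SameRegs s s') (h' : SameRegs s' s'') :
    SameRegs s s'' := fun r hr => (h' r hr).trans (h r hr)

/-- The integer registers hold the dimension, the constants and the powers of `n + 1`. -/
structure Env (n k : ℕ) (s : State) : Prop where
  dim : s.natReg 0 = n
  one : s.natReg 1 = 1
  dim_succ : s.natReg 2 = n + 1
  zero : s.natReg 3 = 0
  base : s.natReg 9 = (n + 1) ^ k + 1
  pow : ∀ j ≤ k, s.natReg (10 + j) = (n + 1) ^ j

theorem Env.of_sameRegs {n k : ℕ} {s s' : State} (h : Env n k s) (hs : SameRegs s s') :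
    Env n k s' where
  dim := (hs 0 (by omega)).trans h.dim
  one := (hs 1 (by omega)).trans h.one
  dim_succ := (hs 2 (by omega)).trans h.dim_succ
  zero := (hs 3 (by omega)).trans h.zero
  base := (hs 9 (by omega)).trans h.base
  pow j hj := (hs (10 + j) (by omega)).trans (h.pow j hj)

/-! ### Powers of the number of digits -/

/-- `N[11 + j] := N[10 + j] * N[2]`. -/
def mulPow (j : ℕ) : Program :=
  .seq (.instr (.natConst (11 + j) 0)) (forLoop 4 2 (.instr (.natAdd (11 + j) (11 + j) (10 + j))))

theorem halts_mulPow {j N : ℕ} (h1 : s.natReg 1 = 1) (h2 : s.natReg 2 = N) :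
    Halts ω (mulPow j) s (3 * N + 3) fun s' => s'.mem = s.mem ∧ s'.drawn = s.drawn ∧
      (∀ r, r ≠ 4 → r ≠ 11 + j → s'.natReg r = s.natReg r) ∧
      s'.natReg (11 + j) = N * s.natReg (10 + j) := by
  refine Halts.mono (T := 1 + (N * (1 + 2) + 2)) (Halts.seq (Halts.instr
    (Halts.forLoop (I := fun i st => st.natReg 4 = i ∧ st.mem = s.mem ∧ st.drawn = s.drawn ∧
      (∀ r, r ≠ 4 → r ≠ 11 + j → st.natReg r = s.natReg r) ∧
      st.natReg (11 + j) = i * s.natReg (10 + j)) ?_ ?_ ?_))) (by omega) fun s' h => h.2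
  · rintro i st ⟨hi, -, -, hr, -⟩
    exact ⟨hi, by rw [hr 2 (by omega) (by omega), h2]⟩
  · simp only [Instr.run, State.setNat, Function.update_apply]
    refine ⟨by simp, trivial, trivial, fun r hr hr' => by simp [hr, hr'], by simp⟩
  · rintro i st - ⟨hi, hm, hd, hr, hp⟩
    refine Halts.instr ?_
    simp only [Instr.run, State.setNat, Function.update_apply]
    refine ⟨by simp [hi, show 4 ≠ 11 + j by omega],
      by simp [hr 1 (by omega) (by omega), h1, show 1 ≠ 11 + j by omega], by simp, hm, hd,
      fun r hr1 hr2 => by simp [hr1, hr2, hr r hr1 hr2], ?_⟩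
    simp only [show 11 + j ≠ 4 by omega, if_false, if_true, hp,
      hr (10 + j) (by omega) (by omega)]
    ring

/-- Computes the powers `(n + 1) ^ j` for all `j ≤ k`. -/
def powers : ℕ → Program
  | 0 => .instr (.natConst 10 1)
  | k + 1 => .seq (powers k) (mulPow k)

/-- The program text depends on k only. Each multiplication by n + 1 is a loop of additions, so its
cost is linear in n. -/
theorem halts_powers {n : ℕ} (k : ℕ) (h1 : s.natReg 1 = 1) (h2 : s.natReg 2 = n + 1) :
    Halts ω (powers k) s (k * (3 * (n + 1) + 3) + 1) fun s' => s'.mem = s.mem ∧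
      s'.drawn = s.drawn ∧ (∀ r, r < 4 → s'.natReg r = s.natReg r) ∧
      ∀ j ≤ k, s'.natReg (10 + j) = (n + 1) ^ j := by
  induction k with
  | zero =>
    refine Halts.mono (Halts.instr (Q := fun s' => s'.mem = s.mem ∧
      s'.drawn = s.drawn ∧ (∀ r, r < 4 → s'.natReg r = s.natReg r) ∧
      ∀ j ≤ 0, s'.natReg (10 + j) = (n + 1) ^ j) ?_) (by omega) fun _ h => h
    simp only [Instr.run, State.setNat, Function.update_apply]
    refine ⟨trivial, trivial, fun r hr => by simp [show r ≠ 10 by omega], fun j hj => ?_⟩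
    simp [Nat.le_zero.mp hj]
  | succ k ih =>
    refine Halts.mono (T := (k * (3 * (n + 1) + 3) + 1) + (3 * (n + 1) + 3))
      (Halts.seq (ih.mono le_rfl fun s' hs' => ?_)) ?_ fun _ h => h
    · obtain ⟨hm, hd, hr, hp⟩ := hs'
      refine (halts_mulPow (j := k) ((hr 1 (by omega)).trans h1)
        ((hr 2 (by omega)).trans h2)).mono le_rfl fun s'' h => ?_
      obtain ⟨hm', hd', hr', hp'⟩ := h
      refine ⟨hm'.trans hm, hd'.trans hd,
        fun r hr4 => (hr' r (by omega) (by omega)).trans (hr r hr4), fun j hj => ?_⟩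
      rcases Nat.lt_or_ge j (k + 1) with hlt | hge
      · rw [hr' _ (by omega) (by omega), hp j (by omega)]
      · obtain rfl : j = k + 1 := by omega
        rw [show 10 + (k + 1) = 11 + k by omega, hp', hp k le_rfl, pow_succ']
    · rw [Nat.succ_mul k]
      omega

/-- Initializes the integer registers. -/
def setup (k : ℕ) : Program :=
  .seq (.instr (.natConst 1 1)) (.seq (.instr (.natAdd 2 0 1))
    (.seq (powers k) (.instr (.natAdd 9 (10 + k) 1))))

/-- Register 3 is never written and keeps its initial 0. The base in register 9 is one past (n +
1)^k, so the zero following the tensor survives. -/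
theorem halts_setup {n k : ℕ} {x : ℕ → ℝ} :
    Halts ω (setup k) (init n x) (k * (3 * (n + 1) + 3) + 4) fun s' =>
      s'.mem = x ∧ s'.drawn = 0 ∧ Env n k s' := by
  refine Halts.mono (T := 1 + (1 + ((k * (3 * (n + 1) + 3) + 1) + 1)))
    (Halts.seq (Halts.instr (Halts.seq (Halts.instr (Halts.seq
      ((halts_powers (n := n) k ?_ ?_).mono le_rfl fun s' h => Halts.instr ?_))))))
    (by omega) fun _ h => h
  · simp [Instr.run, State.setNat]
  · simp [Instr.run, State.setNat, init]
  · obtain ⟨hm, hd, hr, hp⟩ := h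
    have h0 := hr 0 (by omega)
    have h1 := hr 1 (by omega)
    have h2 := hr 2 (by omega)
    have h3 := hr 3 (by omega)
    simp only [Instr.run, State.setNat, Function.update_apply, init] at hm hd h0 h1 h2 h3 ⊢
    refine ⟨hm, hd, by simpa using h0, by simpa using h1, by simpa using h2, by simpa using h3, ?_,
      fun j hj => ?_⟩
    · simp [hp k le_rfl, h1]
    · simp [show 10 + j ≠ 9 by omega, hp j hj]

/-! ### Gaussian vectors -/

/-- Writes `N[0]` fresh Gaussian random numbers to the addresses from `N[9]` on. -/
def drawVec : Program :=
  forLoop 4 0 (.seq (.instr (.gauss 0)) (.seq (.instr (.natAdd 5 9 4)) (.instr (.store 5 0))))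

theorem halts_drawVec {n k : ℕ} (h : Env n k s) :
    Halts ω drawVec s (n * 5 + 2) fun s' => SameRegs s s' ∧ s'.drawn = s.drawn + n ∧
      (∀ i < n, s'.mem ((n + 1) ^ k + 1 + i) = ω (s.drawn + i)) ∧
      ∀ a ≤ (n + 1) ^ k, s'.mem a = s.mem a := by
  refine Halts.mono (Halts.forLoop (T := 3) (B := n)
      (I := fun j st => st.natReg 4 = j ∧ SameRegs s st ∧ st.drawn = s.drawn + j ∧ (∀ i < j, st.mem ((n + 1) ^ k + 1 + i) = ω (s.drawn + i)) ∧
      ∀ a ≤ (n + 1) ^ k, st.mem a = s.mem a) ?_ ?_ ?_) (by omega) fun s' h => h.2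
  · rintro j st ⟨hj, hr, -⟩
    exact ⟨hj, (h.of_sameRegs hr).dim⟩
  · simp only [State.setNat, Function.update_apply]
    refine ⟨by simp, fun r hr => by simp [show r ≠ 4 by omega], by simp,
      by simp, by simp⟩
  · rintro j st hjn ⟨hj, hr, hd, hm, hm'⟩
    have hE := h.of_sameRegs hr
    refine Halts.seq (Halts.instr (Halts.seq (Halts.instr (Halts.instr ?_))))
    simp only [Instr.run, State.setNat, State.setReal, Function.update_apply]
    refine ⟨by simp [hj], by simp [hE.one], by simp, fun r hr' => ?_, by simp [hd]; omega,
      fun i hi => ?_, fun a ha => ?_⟩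
    · simp [show r ≠ 4 by omega, show r ≠ 5 by omega, hr r hr']
    · simp only [hE.base, hj, if_true]
      rcases Nat.lt_or_ge i j with hlt | hge
      · simp [show i ≠ j by omega, hm i hlt]
      · simp [show i = j by omega, hd]
    · simp [hE.base, hj, hm' a ha, show a ≠ (n + 1) ^ k + 1 + j by omega]

/-! ### Contraction -/

/-- Contracts the digit with weight `N[10 + d]` of the tensor in the memory with the vector at
the addresses from `N[10 + k]` on. -/
def contract (k d : ℕ) : Program :=
  -- Adding register 3, which holds 0, copies an integer register.
  forLoop 4 (10 + d) (.seq (.instr (.realConst 0 0)) (.seq (.instr (.natAdd 5 4 3))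
    (.seq (.instr (.natAdd 6 (10 + k) 3)) (.seq
      (forLoop 7 2 (.seq (.instr (.load 1 5)) (.seq (.instr (.load 2 6))
        (.seq (.instr (.realMul 1 1 2)) (.seq (.instr (.realAdd 0 0 1))
          (.seq (.instr (.natAdd 5 5 (10 + d))) (.instr (.natAdd 6 6 1))))))))
      (.instr (.store 4 0))))))

theorem halts_contract_inner {n k d a : ℕ} (h : Env n k s) (hd : d ≤ k) (h4 : s.natReg 4 = a)
    (h5 : s.natReg 5 = a) (h6 : s.natReg 6 = (n + 1) ^ k) (hR : s.realReg 0 = 0) :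
    Halts ω (forLoop 7 2 (.seq (.instr (.load 1 5)) (.seq (.instr (.load 2 6))
        (.seq (.instr (.realMul 1 1 2)) (.seq (.instr (.realAdd 0 0 1))
          (.seq (.instr (.natAdd 5 5 (10 + d))) (.instr (.natAdd 6 6 1)))))))) s
      ((n + 1) * 8 + 2) fun s' => SameRegs s s' ∧ s'.drawn = s.drawn ∧ s'.mem = s.mem ∧
        s'.natReg 4 = a ∧ s'.realReg 0 = ∑ i ∈ Finset.range (n + 1),
          s.mem (a + i * (n + 1) ^ d) * s.mem ((n + 1) ^ k + i) := by
  refine Halts.mono (Halts.forLoop (T := 6) (B := n + 1)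
      (I := fun j st => st.natReg 7 = j ∧ SameRegs s st ∧
      st.drawn = s.drawn ∧ st.mem = s.mem ∧ st.natReg 4 = a ∧
      st.natReg 5 = a + j * (n + 1) ^ d ∧ st.natReg 6 = (n + 1) ^ k + j ∧
      st.realReg 0 = ∑ i ∈ Finset.range j,
          s.mem (a + i * (n + 1) ^ d) * s.mem ((n + 1) ^ k + i)) ?_ ?_ ?_) (by omega)
    fun s' h => ⟨h.2.1, h.2.2.1, h.2.2.2.1, h.2.2.2.2.1, h.2.2.2.2.2.2.2⟩
  · rintro j st ⟨hj, hr, -⟩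
    exact ⟨hj, (h.of_sameRegs hr).dim_succ⟩
  · simp only [State.setNat, Function.update_apply]
    refine ⟨by simp, fun r hr => by simp [show r ≠ 7 by omega], by simp,
      by simp, by simp [h4], by simp [h5], by simp [h6], by simp [hR]⟩
  · rintro j st hjn ⟨hj, hr, hdr, hm, hr4, hr5, hr6, hr0⟩
    have hE := h.of_sameRegs hr
    have hpd := hE.pow d hd
    refine Halts.seq (Halts.instr (Halts.seq (Halts.instr (Halts.seq (Halts.instr (Halts.seq
      (Halts.instr (Halts.seq (Halts.instr (Halts.instr ?_))))))))))
    simp only [Instr.run, State.setNat, State.setReal, Function.update_apply]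
    refine ⟨by simp [hj], by simp [hE.one], by simp, fun r hr' => ?_, by simp [hdr],
      by simp [hm], by simp [hr4], ?_, ?_, ?_⟩
    · simp [show r ≠ 5 by omega, show r ≠ 6 by omega,
        show r ≠ 7 by omega, hr r hr']
    · simp [hr5, hpd]
      ring
    · simp [hr6, hE.one]
      ring
    · simp [hr0, hm, hr5, hr6, Finset.sum_range_succ]

/-- Working in place is safe: entry a reads tensor cells with addresses at least a and vector cells
beyond the tensor, while only cells below a have been overwritten by then. -/
theorem halts_contract {n k d : ℕ} (h : Env n k s) (hd : d + 1 ≤ k) :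
    Halts ω (contract k d) s ((n + 1) ^ d * ((n + 1) * 8 + 8) + 2) fun s' =>
      SameRegs s s' ∧ s'.drawn = s.drawn ∧
      (∀ a < (n + 1) ^ d, s'.mem a = ∑ i ∈ Finset.range (n + 1),
        s.mem (a + i * (n + 1) ^ d) * s.mem ((n + 1) ^ k + i)) ∧
      ∀ a, (n + 1) ^ d ≤ a → s'.mem a = s.mem a := by
  have hle : (n + 1) ^ d ≤ (n + 1) ^ k := Nat.pow_le_pow_right (by omega) (by omega)
  refine Halts.mono (Halts.forLoop (T := 1 + (1 + (1 + (((n + 1) * 8 + 2) + 1))))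
      (B := (n + 1) ^ d)
      (I := fun j st => st.natReg 4 = j ∧ SameRegs s st ∧ st.drawn = s.drawn ∧
      (∀ a < j, st.mem a = ∑ i ∈ Finset.range (n + 1),
        s.mem (a + i * (n + 1) ^ d) * s.mem ((n + 1) ^ k + i)) ∧
      ∀ a, j ≤ a → st.mem a = s.mem a) ?_ ?_ ?_)
      (by gcongr (n + 1) ^ d * ?_ + 2; omega) fun s' h => h.2
  · rintro j st ⟨hj, hr, -⟩
    exact ⟨hj, (h.of_sameRegs hr).pow d (by omega)⟩
  · simp only [State.setNat, Function.update_apply]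
    refine ⟨by simp, fun r hr => by simp [show r ≠ 4 by omega], by simp,
      by simp, by simp⟩
  · rintro j st hjn ⟨hj, hr, hdr, hm, hm'⟩
    have hE := h.of_sameRegs hr
    have hpk := hE.pow k le_rfl
    refine Halts.seq (Halts.instr (Halts.seq (Halts.instr (Halts.seq (Halts.instr (Halts.seq
      ((halts_contract_inner (n := n) (k := k) (d := d) (a := j) (hE.of_sameRegs ?_) (by omega)
        ?_ ?_ ?_ ?_).mono le_rfl fun st' hst' => Halts.instr ?_)))))))
    · intro r hr'
      simp [Instr.run, State.setNat, State.setReal, Function.update_apply,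
        show r ≠ 5 by omega, show r ≠ 6 by omega]
    · simp [Instr.run, State.setNat, State.setReal, Function.update_apply, hj]
    · simp [Instr.run, State.setNat, State.setReal, Function.update_apply, hj, hE.zero]
    · simp [Instr.run, State.setNat, State.setReal, hpk, hE.zero, show 10 + k ≠ 5 by omega]
    · simp [Instr.run, State.setNat, State.setReal, Function.update_apply]
    · obtain ⟨hr', hdr', hmem, hr4, hr0⟩ := hst'
      have hr2 : SameRegs st st' := SameRegs.trans (s' := _) (fun r hr'' => by
        simp [Instr.run, State.setNat, State.setReal, Function.update_apply,
          show r ≠ 5 by omega, show r ≠ 6 by omega]) hr'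
      have hE' := hE.of_sameRegs hr2
      simp only [Instr.run, State.setNat, State.setReal] at hmem hdr' hr0 ⊢
      refine ⟨hr4, hE'.one, by simp, fun r hr'' => ?_, hdr'.trans hdr, fun a ha => ?_,
        fun a ha => ?_⟩
      · simp [show r ≠ 4 by omega, hr2 r hr'', hr r hr'']
      · rw [hr4, Function.update_apply, hmem]
        rcases Nat.lt_or_ge a j with hlt | hge
        · rw [if_neg (by omega), hm a hlt]
        · obtain rfl : a = j := by omega
          rw [if_pos rfl, hr0]
          refine Finset.sum_congr rfl fun i _ => ?_
          rw [hm' _ (by omega), hm' _ (by omega)]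
      · rw [hr4, Function.update_apply, if_neg (by omega), hmem, hm' a (by omega)]

/-! ### Normalization -/

/-- `R[0] := ∑ i < n, mem[i + 1] ^ 2`. -/
def sumSq : Program :=
  .seq (.instr (.realConst 0 0)) (forLoop 4 0 (.seq (.instr (.natAdd 5 4 1))
    (.seq (.instr (.load 1 5)) (.seq (.instr (.realMul 1 1 1)) (.instr (.realAdd 0 0 1))))))

theorem halts_sumSq {n k : ℕ} (h : Env n k s) :
    Halts ω sumSq s (n * 6 + 3) fun s' => SameRegs s s' ∧ s'.mem = s.mem ∧
      s'.realReg 0 = ∑ i ∈ Finset.range n, s.mem (i + 1) ^ 2 := by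
  refine Halts.mono (T := 1 + (n * (4 + 2) + 2)) (Halts.seq (Halts.instr (Halts.forLoop
    (I := fun j st => st.natReg 4 = j ∧ SameRegs s st ∧ st.mem = s.mem ∧
      st.realReg 0 = ∑ i ∈ Finset.range j, s.mem (i + 1) ^ 2) ?_ ?_ ?_))) (by omega)
    fun s' h => h.2
  · rintro j st ⟨hj, hr, -⟩
    exact ⟨hj, (h.of_sameRegs hr).dim⟩
  · simp only [Instr.run, State.setReal, State.setNat, Function.update_apply]
    refine ⟨by simp, fun r hr => by simp [show r ≠ 4 by omega], by simp,
      by simp⟩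
  · rintro j st hjn ⟨hj, hr, hm, hr0⟩
    have hE := h.of_sameRegs hr
    refine Halts.seq (Halts.instr (Halts.seq (Halts.instr (Halts.seq (Halts.instr
      (Halts.instr ?_))))))
    simp only [Instr.run, State.setNat, State.setReal, Function.update_apply]
    refine ⟨by simp [hj], by simp [hE.one], by simp, fun r hr' => ?_, by simp [hm], ?_⟩
    · simp [show r ≠ 4 by omega, show r ≠ 5 by omega, hr r hr']
    · simp [hr0, hm, hj, hE.one, Finset.sum_range_succ, sq]

/-- `mem[i] := mem[i + 1] / R[0]` for `i < n`. -/
def divide : Program :=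
  forLoop 4 0 (.seq (.instr (.natAdd 5 4 1)) (.seq (.instr (.load 1 5))
    (.seq (.instr (.realDiv 1 1 0)) (.instr (.store 4 1)))))

theorem halts_divide {n k : ℕ} (h : Env n k s) :
    Halts ω divide s (n * 6 + 2) fun s' => ∀ i < n, s'.mem i = s.mem (i + 1) / s.realReg 0 := by
  refine Halts.mono (Halts.forLoop (T := 4) (B := n)
    (I := fun j st => st.natReg 4 = j ∧ SameRegs s st ∧ st.realReg 0 = s.realReg 0 ∧
      (∀ i < j, st.mem i = s.mem (i + 1) / s.realReg 0) ∧
      ∀ i, j ≤ i → st.mem i = s.mem i) ?_ ?_ ?_) (by omega) fun s' h => h.2.2.2.1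
  · rintro j st ⟨hj, hr, -⟩
    exact ⟨hj, (h.of_sameRegs hr).dim⟩
  · simp only [State.setNat, Function.update_apply]
    refine ⟨by simp, fun r hr => by simp [show r ≠ 4 by omega], by simp,
      by simp, by simp⟩
  · rintro j st hjn ⟨hj, hr, hr0, hm, hm'⟩
    have hE := h.of_sameRegs hr
    refine Halts.seq (Halts.instr (Halts.seq (Halts.instr (Halts.seq (Halts.instr
      (Halts.instr ?_))))))
    simp only [Instr.run, State.setNat, State.setReal, Function.update_apply]
    refine ⟨by simp [hj], by simp [hE.one], by simp, fun r hr' => ?_, by simp [hr0],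
      fun i hi => ?_, fun i hi => ?_⟩
    · simp [show r ≠ 4 by omega, show r ≠ 5 by omega, hr r hr']
    · rcases Nat.lt_or_ge i j with hlt | hge
      · simp [hj, show i ≠ j by omega, hm i hlt]
      · obtain rfl : i = j := by omega
        simp [hj, hE.one, hr0, hm']
    · simp [hj, show i ≠ j by omega, hm' i (by omega)]

/-- Writes the normalization of the vector `(mem[1], …, mem[n])`, or the first unit vector if
this is zero, to the first `n` memory cells. -/
def normalize : Program :=
  .seq sumSq (.seq (.instr (.realConst 2 0))
    (.seq (.ite (.realLt 2 0) (.instr (.realSqrt 0 0))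
      -- Register 1 holds 1, so the value 1 goes to `mem[1]`, the first coordinate; the division
      -- that follows is then by 1.
      (.seq (.instr (.realConst 0 1)) (.instr (.store 1 0)))) divide))

theorem halts_normalize {n k : ℕ} (h : Env n k s) :
    Halts ω normalize s (n * 12 + 9) fun s' =>
      (0 < ∑ i ∈ Finset.range n, s.mem (i + 1) ^ 2 → ∀ i < n,
        s'.mem i = s.mem (i + 1) / Real.sqrt (∑ i ∈ Finset.range n, s.mem (i + 1) ^ 2)) ∧
      (¬ 0 < ∑ i ∈ Finset.range n, s.mem (i + 1) ^ 2 → ∀ i < n,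
        s'.mem i = if i = 0 then 1 else s.mem (i + 1)) := by
  set q : ℝ := ∑ i ∈ Finset.range n, s.mem (i + 1) ^ 2 with hq
  refine Halts.mono (T := (n * 6 + 3) + (1 + ((2 + 1) + (n * 6 + 2)))) (Halts.seq
    ((halts_sumSq h).mono le_rfl fun st hst => Halts.seq (Halts.instr (Halts.seq (Halts.ite
      (fun hb => Halts.mono (Halts.instr ((halts_divide (n := n) (k := k) ?_).mono le_rfl ?_))
        (by omega) fun _ h => h)
      (fun hb => Halts.seq (Halts.instr (Halts.instr ((halts_divide (n := n) (k := k) ?_).mono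
        le_rfl ?_)))))))))
    (by omega) fun _ h => h
  all_goals
    obtain ⟨hr, hm, h0⟩ := hst
    have hE := h.of_sameRegs hr
    rw [← hq] at h0
    try simp only [Test.Holds, Instr.run, State.setReal, Function.update_apply] at hb
  · exact hE.of_sameRegs fun r hr' => by simp [Instr.run, State.setReal]
  · intro s' hs'
    have hb' : 0 < q := by simpa [h0] using hb
    refine ⟨fun _ i hi => ?_, fun hn => absurd hb' hn⟩
    rw [hs' i hi]
    simp [Instr.run, State.setReal, hm, h0]
  · exact hE.of_sameRegs fun r hr' => by simp [Instr.run, State.setReal]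
  · intro s' hs'
    have hb' : ¬ 0 < q := by simpa [h0] using hb
    refine ⟨fun hn => absurd hn hb', fun _ i hi => ?_⟩
    rw [hs' i hi]
    simp [Instr.run, State.setReal, hm, hE.one, Function.update_apply]

end RealRAM

namespace RealRAM

variable {ω : ℕ → ℝ} {s : State}

/-! ### The sampling algorithm -/

/-- The memory holds the tensor `L (Q * (1, u) ⊗ ⋯ ⊗ (1, u))` of order `d`, followed by a zero at
the address `(n + 1) ^ k`. -/
structure HoldsTensor {n : ℕ} (k : ℕ) (L : MvPolynomial (Fin n) ℝ →ₗ[ℝ] ℝ)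
    (Q : MvPolynomial (Fin n) ℝ) (d : ℕ) (s : State) : Prop where
  entry : ∀ a < (n + 1) ^ d,
    s.mem a = L (Q * ∏ j : Fin d, extVar n (Fin.ofNat (n + 1) (a / (n + 1) ^ (j : ℕ))))
  pad : s.mem ((n + 1) ^ k) = 0

/-- `Fin.ofNat` reduces modulo n + 1, so the digits below position d do not see multiples of (n +
1)^d. -/
theorem ofNat_add_mul_pow_div {n d j a i : ℕ} (hj : j < d) :
    Fin.ofNat (n + 1) ((a + i * (n + 1) ^ d) / (n + 1) ^ j)
      = Fin.ofNat (n + 1) (a / (n + 1) ^ j) := by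
  obtain ⟨e, rfl⟩ := Nat.exists_eq_add_of_lt hj
  have h1 : a + i * (n + 1) ^ (j + e + 1)
      = a + (n + 1) ^ j * ((n + 1) * (i * (n + 1) ^ e)) := by ring
  rw [h1, Nat.add_mul_div_left _ _ (by positivity)]
  ext
  simp [Fin.ofNat]

theorem extVar_ofNat_succ {n d a : ℕ} (ha : a < (n + 1) ^ d) (i : Fin n) :
    extVar n (Fin.ofNat (n + 1) ((a + (i + 1) * (n + 1) ^ d) / (n + 1) ^ d))
      = MvPolynomial.X i := by
  have h1 : (a + (i + 1) * (n + 1) ^ d) / (n + 1) ^ d = i + 1 := by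
    rw [mul_comm, Nat.add_mul_div_left _ _ (by positivity), Nat.div_eq_of_lt ha, zero_add]
  have h2 : Fin.ofNat (n + 1) ((i : ℕ) + 1) = i.succ := by
    ext
    simp [Fin.ofNat]
  rw [h1, h2, extVar, Fin.cons_succ]

/-- Contraction multiplies the weight of the tensor by a linear form. -/
theorem HoldsTensor.contract {n k d : ℕ} {L : MvPolynomial (Fin n) ℝ →ₗ[ℝ] ℝ}
    {Q : MvPolynomial (Fin n) ℝ} {s s' : State} {v : Fin n → ℝ}
    (h : HoldsTensor k L Q (d + 1) s) (hd : d + 1 ≤ k)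
    (hv : ∀ i : Fin n, s.mem ((n + 1) ^ k + 1 + i) = v i)
    (h1 : ∀ a < (n + 1) ^ d, s'.mem a = ∑ i ∈ Finset.range (n + 1),
        s.mem (a + i * (n + 1) ^ d) * s.mem ((n + 1) ^ k + i))
    (h2 : ∀ a, (n + 1) ^ d ≤ a → s'.mem a = s.mem a) :
    HoldsTensor k L (Q * coordForm v) d s' where
  entry a ha := by
    -- The machine contracts with (0, v): the zero at address (n + 1)^k kills the term of the
    -- constant u₀ = 1.
    rw [h1 a ha, Finset.sum_range_succ', add_zero, h.pad, mul_zero, add_zero,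
      Finset.sum_range (fun i => s.mem (a + (i + 1) * (n + 1) ^ d)
        * s.mem ((n + 1) ^ k + (i + 1))),
      coordForm_eq_sum_smul, mul_assoc, mul_comm (∑ i, v i • MvPolynomial.X i), Finset.mul_sum,
      Finset.mul_sum, map_sum]
    refine Finset.sum_congr rfl fun i _ => ?_
    have hlt : a + (i + 1) * (n + 1) ^ d < (n + 1) ^ (d + 1) := by
      have : (i + 1 + 1) * (n + 1) ^ d ≤ (n + 1) * (n + 1) ^ d :=
        Nat.mul_le_mul_right _ (by omega)
      rw [pow_succ']
      linarith
    rw [h.entry _ hlt, show (n + 1) ^ k + ((i : ℕ) + 1) = (n + 1) ^ k + 1 + i by ring, hv,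
      Fin.prod_univ_castSucc]
    simp only [Fin.val_castSucc, Fin.val_last, ofNat_add_mul_pow_div (Fin.is_lt _),
      extVar_ofNat_succ ha, mul_smul_comm, map_smul, smul_eq_mul]
    ring
  pad := by rw [h2 _ (Nat.pow_le_pow_right (by omega) (by omega)), h.pad]

theorem halts_contract_tensor {n k d : ℕ} {L : MvPolynomial (Fin n) ℝ →ₗ[ℝ] ℝ}
    {Q : MvPolynomial (Fin n) ℝ} {v : Fin n → ℝ} (hE : Env n k s) (hd : d + 1 ≤ k)
    (h : HoldsTensor k L Q (d + 1) s) (hv : ∀ i : Fin n, s.mem ((n + 1) ^ k + 1 + i) = v i) :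
    Halts ω (RealRAM.contract k d) s (18 * (n + 1) ^ k) fun s' => Env n k s' ∧
      s'.drawn = s.drawn ∧ HoldsTensor k L (Q * coordForm v) d s' ∧
      ∀ i : Fin n, s'.mem ((n + 1) ^ k + 1 + i) = v i := by
  refine (halts_contract hE hd).mono ?_ fun s' ⟨hr, hdr, h1, h2⟩ =>
    ⟨hE.of_sameRegs hr, hdr, h.contract hd hv h1 h2, fun i => ?_⟩
  · have h1 : (n + 1) ^ (d + 1) ≤ (n + 1) ^ k := Nat.pow_le_pow_right (by omega) hd
    have h2 : (n + 1) ^ d ≤ (n + 1) ^ (d + 1) := Nat.pow_le_pow_right (by omega) (by omega)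
    have h3 : 1 ≤ (n + 1) ^ d := Nat.one_le_pow _ _ (by omega)
    calc (n + 1) ^ d * ((n + 1) * 8 + 8) + 2
        = 8 * (n + 1) ^ (d + 1) + 8 * (n + 1) ^ d + 2 := by ring
      _ ≤ 18 * (n + 1) ^ k := by omega
  · have : (n + 1) ^ d ≤ (n + 1) ^ k := Nat.pow_le_pow_right (by omega) (by omega)
    rw [h2 _ (by omega), hv]

theorem le_pow_of_pos {n k : ℕ} (hk : 0 < k) : n + 1 ≤ (n + 1) ^ k :=
  Nat.le_self_pow (by omega) _

theorem halts_drawVec_tensor {n k d : ℕ} {L : MvPolynomial (Fin n) ℝ →ₗ[ℝ] ℝ}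
    {Q : MvPolynomial (Fin n) ℝ} (hE : Env n k s) (hd : d ≤ k) (hk : 0 < k)
    (h : HoldsTensor k L Q d s) :
    Halts ω drawVec s (5 * (n + 1) ^ k) fun s' => Env n k s' ∧
      s'.drawn = s.drawn + n ∧ HoldsTensor k L Q d s' ∧
      ∀ i : Fin n, s'.mem ((n + 1) ^ k + 1 + i) = ω (s.drawn + i) := by
  refine (halts_drawVec hE).mono ?_ fun s' ⟨hr, hdr, h1, h2⟩ =>
    ⟨hE.of_sameRegs hr, hdr, ⟨fun a ha => ?_, ?_⟩, fun i => h1 i i.2⟩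
  · have := le_pow_of_pos (n := n) hk
    omega
  · have : (n + 1) ^ d ≤ (n + 1) ^ k := Nat.pow_le_pow_right (by omega) hd
    rw [h2 a (by omega), h.entry a ha]
  · rw [h2 _ le_rfl, h.pad]

/-- Contracts a tensor of order `2 * j + 2` to order `2`, with `j` Gaussian vectors, each of which
is used twice. -/
def reweight (k : ℕ) : ℕ → Program
  | 0 => .instr (.natConst 4 0)
  | j + 1 => .seq drawVec (.seq (contract k (2 * j + 3)) (.seq (contract k (2 * j + 2))
      (reweight k j)))

theorem halts_reweight {n k : ℕ} {L : MvPolynomial (Fin n) ℝ →ₗ[ℝ] ℝ} (j : ℕ) :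
    ∀ {s : State} {Q : MvPolynomial (Fin n) ℝ}, Env n k s → 2 * j + 2 ≤ k →
      HoldsTensor k L Q (2 * j + 2) s →
    Halts ω (reweight k j) s (j * (41 * (n + 1) ^ k) + 1) fun s' => Env n k s' ∧
      s'.drawn = s.drawn + j * n ∧
      HoldsTensor k L (Q * ∏ l ∈ Finset.range j,
        coordForm (fun i : Fin n => ω (s.drawn + l * n + i)) ^ 2) 2 s' := by
  induction j with
  | zero =>
    intro s Q hE hk h
    refine (Halts.instr ?_).mono (by omega) fun _ h => h
    refine ⟨hE.of_sameRegs fun r hr => ?_, by simp [Instr.run, State.setNat], ?_⟩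
    · simp [Instr.run, State.setNat, show r ≠ 4 by omega]
    · simpa [Instr.run, State.setNat] using
        (⟨h.entry, h.pad⟩ : HoldsTensor k L Q 2 ((Instr.natConst 4 0).run ω s))
  | succ j ih =>
    intro s Q hE hk h
    refine Halts.mono (T := 5 * (n + 1) ^ k + (18 * (n + 1) ^ k + (18 * (n + 1) ^ k
        + (j * (41 * (n + 1) ^ k) + 1))))
      (Halts.seq ((halts_drawVec_tensor hE (by omega) (by omega) h).mono le_rfl
        fun s₁ ⟨hE₁, hd₁, h₁, hv₁⟩ => Halts.seq ((halts_contract_tensor hE₁ (by omega) h₁ hv₁).mono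
          le_rfl fun s₂ ⟨hE₂, hd₂, h₂, hv₂⟩ => Halts.seq
            ((halts_contract_tensor hE₂ (by omega) h₂ hv₂).mono le_rfl
              fun s₃ ⟨hE₃, hd₃, h₃, _⟩ => (ih hE₃ (by omega) h₃).mono le_rfl
                fun s₄ ⟨hE₄, hd₄, h₄⟩ => ?_)))) ?_ fun _ h => h
    · rw [Nat.succ_mul j]
      omega
    · have hd : s₃.drawn = s.drawn + n := by rw [hd₃, hd₂, hd₁]
      refine ⟨hE₄, by rw [hd₄, hd]; ring, ?_⟩
      convert! h₄ using 1
      -- The vector drawn first is split off; the recursive call sees the random numbers shifted by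
      -- n.
      rw [Finset.prod_range_succ', hd]
      simp only [zero_mul, add_zero]
      rw [mul_assoc Q, ← sq, mul_comm _ (coordForm _ ^ 2), ← mul_assoc]
      refine congrArg _ (Finset.prod_congr rfl fun l _ => ?_)
      rw [show s.drawn + (l + 1) * n = s.drawn + n + l * n by ring]

/-- The sampling algorithm for pseudo-distributions of degree `2 * m + 2`. -/
def sampler (m : ℕ) : Program :=
  .seq (setup (2 * m + 2)) (.seq (reweight (2 * m + 2) m) (.seq drawVec
    (.seq (contract (2 * m + 2) 1) normalize)))

/-- The sample before normalization. -/
noncomputable def rawSample {n : ℕ} (m : ℕ) (L : MvPolynomial (Fin n) ℝ →ₗ[ℝ] ℝ) (ω : ℕ → ℝ)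
    (i : Fin n) : ℝ :=
  L (weightPoly (blocks (m + 1) n ω)
    * (coordForm (blocks (m + 1) n ω (Fin.last m)) * MvPolynomial.X i))

theorem holdsTensor_of_mem_eq {n k : ℕ} {L : MvPolynomial (Fin n) ℝ →ₗ[ℝ] ℝ} {s : State}
    (h : s.mem = momentList k L) : HoldsTensor k L 1 k s where
  entry a ha := by rw [h, momentList, if_pos ha, one_mul]
  pad := by rw [h, momentList, if_neg (lt_irrefl _)]

theorem halts_sampler {n : ℕ} (m : ℕ) (L : MvPolynomial (Fin n) ℝ →ₗ[ℝ] ℝ) :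
    Halts ω (sampler m) (init n (momentList (2 * m + 2) L))
      (128 * (2 * m + 2) * (n + 1) ^ (2 * m + 2)) fun s =>
      (0 < ∑ i, rawSample m L ω i ^ 2 → ∀ i : Fin n, s.mem i
        = rawSample m L ω i / Real.sqrt (∑ i, rawSample m L ω i ^ 2)) ∧
      (¬ 0 < ∑ i, rawSample m L ω i ^ 2 → ∀ i : Fin n, s.mem i = if (i : ℕ) = 0 then 1
        else rawSample m L ω i) := by
  set k := 2 * m + 2 with hk
  refine Halts.mono (T := (k * (3 * (n + 1) + 3) + 4) + ((m * (41 * (n + 1) ^ k) + 1)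
      + (5 * (n + 1) ^ k + (18 * (n + 1) ^ k + (n * 12 + 9)))))
    (Halts.seq (halts_setup.mono le_rfl fun s₁ ⟨hm₁, hd₁, hE₁⟩ => Halts.seq
      ((halts_reweight (L := L) (Q := 1) m hE₁ (by omega) (holdsTensor_of_mem_eq hm₁)).mono le_rfl
        fun s₂ ⟨hE₂, hd₂, h₂⟩ => Halts.seq
          ((halts_drawVec_tensor hE₂ (by omega) (by omega) h₂).mono le_rfl
            fun s₃ ⟨hE₃, hd₃, h₃, hv₃⟩ => Halts.seq
              ((halts_contract_tensor hE₃ (by omega) h₃ hv₃).mono le_rfl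
                fun s₄ ⟨hE₄, hd₄, h₄, hv₄⟩ => (halts_normalize hE₄).mono le_rfl
                  fun s₅ h₅ => ?_))))) ?_ fun _ h => h
  -- Cell 0 of the remaining tensor of order 1 belongs to u₀ = 1, so the sample occupies cells 1, …,
  -- n.
  · have hV : ∀ i : Fin n, s₄.mem (i + 1) = rawSample m L ω i := by
      intro i
      rw [h₄.entry _ (by rw [pow_one]; omega), rawSample, hd₂, hd₁]
      have hX : ∏ j : Fin 1, extVar n (Fin.ofNat (n + 1) ((i + 1) / (n + 1) ^ (j : ℕ)))
          = MvPolynomial.X i := by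
        have := extVar_ofNat_succ (n := n) (d := 0) (a := 0) (by simp) i
        simpa using this
      have hW : ∏ l ∈ Finset.range m, coordForm (fun i : Fin n => ω (0 + l * n + i)) ^ 2
          = weightPoly (blocks (m + 1) n ω) := by
        rw [Finset.prod_range fun l => coordForm (fun i : Fin n => ω (0 + l * n + i)) ^ 2]
        simp only [zero_add]
        rfl
      rw [hX, hW]
      simp only [zero_add, one_mul, mul_assoc]
      rfl
    have hsum : ∑ i ∈ Finset.range n, s₄.mem (i + 1) ^ 2 = ∑ i, rawSample m L ω i ^ 2 := by
      rw [Finset.sum_range fun i => s₄.mem (i + 1) ^ 2]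
      simp only [hV]
    rw [hsum] at h₅
    refine ⟨fun hp i => ?_, fun hp i => ?_⟩
    · rw [h₅.1 hp i i.2, hV]
    · rw [h₅.2 hp i i.2, hV]
  · have h1 : n + 1 ≤ (n + 1) ^ k := le_pow_of_pos (by omega)
    generalize (n + 1) ^ k = P at *
    have h2 : k * (3 * (n + 1) + 3) ≤ k * (6 * P) := Nat.mul_le_mul_left _ (by omega)
    have h3 : m * (41 * P) ≤ k * (41 * P) := Nat.mul_le_mul_right _ (by omega)
    have h4 : 2 * P ≤ k * P := Nat.mul_le_mul_right _ (by omega)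
    nlinarith

end RealRAM

/-! ### Normalized output and numerical bounds. -/

namespace RealRAM

/-- The coordinates of the normalization of `v`, or of the first unit vector if `v = 0`. -/
noncomputable def normalizeVec {n : ℕ} (v : Fin n → ℝ) (i : Fin n) : ℝ :=
  if 0 < ∑ a, v a ^ 2 then v i / Real.sqrt (∑ a, v a ^ 2) else if (i : ℕ) = 0 then 1 else v i

theorem sum_normalizeVec_sq {n : ℕ} (hn : 0 < n) (v : Fin n → ℝ) :
    ∑ i, normalizeVec v i ^ 2 = 1 := by
  unfold normalizeVec
  split_ifs with h
  · simp only [div_pow, Real.sq_sqrt h.le, ← Finset.sum_div]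
    exact div_self h.ne'
  · have h0 : ∑ a, v a ^ 2 = 0 :=
      le_antisymm (not_lt.mp h) (Finset.sum_nonneg fun _ _ => sq_nonneg _)
    have hv : ∀ a, v a = 0 := fun a => by
      have := (Finset.sum_eq_zero_iff_of_nonneg fun i _ => sq_nonneg (v i)).mp h0 a
        (Finset.mem_univ a)
      exact pow_eq_zero_iff two_ne_zero |>.mp this
    rw [Finset.sum_eq_single (⟨0, hn⟩ : Fin n)]
    · simp
    · intro b _ hb
      have : (b : ℕ) ≠ 0 := fun h => hb (Fin.ext h)
      simp [this, hv]
    · simp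

theorem exists_exec_sampler {n : ℕ} (m : ℕ) (L : MvPolynomial (Fin n) ℝ →ₗ[ℝ] ℝ) (ω : ℕ → ℝ) :
    ∃ (s : State) (t : ℕ), Exec ω (sampler m) (init n (momentList (2 * m + 2) L)) s t ∧
      t ≤ 128 * (2 * m + 2) * (n + 1) ^ (2 * m + 2) ∧
      s.output n = WithLp.toLp 2 (normalizeVec (rawSample m L ω)) := by
  obtain ⟨s, t, h, ht, h1, h2⟩ := halts_sampler (ω := ω) m L
  refine ⟨s, t, h, ht, ?_⟩
  rw [State.output]
  congr 1
  ext i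
  unfold normalizeVec
  split_ifs with hp h0
  · exact h1 hp i
  · rw [h2 hp i, if_pos h0]
  · rw [h2 hp i, if_neg h0]

/-- With k = 2m + 2 and M = max(n, 2), the factors 128, k and (n + 1)^k cost exponents 7, k and 2k;
since k ≥ 2, the total is at most 10k. -/
theorem time_bound (n m : ℕ) : 128 * (2 * m + 2) * (n + 1) ^ (2 * m + 2)
    ≤ (max n 2) ^ (10 * (2 * m + 2)) := by
  set M := max n 2 with hM
  have h2 : 2 ≤ M := le_max_right _ _
  have hn : n ≤ M := le_max_left _ _
  have h1 : n + 1 ≤ M ^ 2 := by nlinarith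
  calc 128 * (2 * m + 2) * (n + 1) ^ (2 * m + 2)
      ≤ 2 ^ 7 * 2 ^ (2 * m + 2) * (M ^ 2) ^ (2 * m + 2) := by
        gcongr
        · norm_num
        · exact Nat.lt_two_pow_self.le
    _ ≤ M ^ 7 * M ^ (2 * m + 2) * (M ^ 2) ^ (2 * m + 2) := by gcongr
    _ = M ^ (7 + (2 * m + 2) + 2 * (2 * m + 2)) := by rw [← pow_mul, ← pow_add, ← pow_add]
    _ ≤ M ^ (10 * (2 * m + 2)) := Nat.pow_le_pow_right (by omega) (by omega)

theorem norm_output_eq_one {n : ℕ} (hn : 0 < n) (v : Fin n → ℝ) :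
    ‖(WithLp.toLp 2 (normalizeVec v) : EuclideanSpace ℝ (Fin n))‖ = 1 := by
  rw [EuclideanSpace.norm_eq]
  simp [sum_normalizeVec_sq hn]

theorem inner_normalizeVec {n : ℕ} (c : EuclideanSpace ℝ (Fin n)) {v : Fin n → ℝ}
    (hv : 0 < ∑ a, v a ^ 2) :
    inner ℝ c (WithLp.toLp 2 (normalizeVec v) : EuclideanSpace ℝ (Fin n))
      = (∑ a, c a * v a) / Real.sqrt (∑ a, v a ^ 2) := by
  rw [PiLp.inner_apply, Finset.sum_div]
  refine Finset.sum_congr rfl fun a _ => ?_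
  simp [normalizeVec, hv]
  ring

/-- A sample with a small orthogonal component is close to `c` after normalization. -/
theorem one_sub_le_inner {n : ℕ} {c : EuclideanSpace ℝ (Fin n)} (hc : ∑ a, c a ^ 2 = 1)
    {v : Fin n → ℝ} {y x : ℝ} (hy : 0 < y) (hvy : ∑ a, c a * v a = y)
    (hp : ∑ a, (v a - c a * y) ^ 2 ≤ 2 * x * y ^ 2) :
    1 - x ≤ inner ℝ c (WithLp.toLp 2 (normalizeVec v) : EuclideanSpace ℝ (Fin n)) := by
  have hq : ∑ a, (v a - c a * y) ^ 2 = ∑ a, v a ^ 2 - y ^ 2 := by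
    have h1 : ∀ a, (v a - c a * y) ^ 2 = v a ^ 2 - 2 * y * (c a * v a) + y ^ 2 * c a ^ 2 :=
      fun a => by ring
    simp only [h1, Finset.sum_add_distrib, Finset.sum_sub_distrib, ← Finset.mul_sum, hvy, hc]
    ring
  have hq0 : 0 ≤ ∑ a, (v a - c a * y) ^ 2 := Finset.sum_nonneg fun _ _ => sq_nonneg _
  have hpos : 0 < ∑ a, v a ^ 2 := by
    have : 0 < y ^ 2 := by positivity
    linarith
  rw [inner_normalizeVec c hpos, hvy, le_div_iff₀ (Real.sqrt_pos.mpr hpos)]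
  rcases le_or_gt 1 x with h1 | h1
  · have := mul_nonneg (sub_nonneg.mpr h1) (Real.sqrt_nonneg (∑ a, v a ^ 2))
    nlinarith
  -- For x < 1, squaring reduces the claim to (1 − x)²(1 + 2x) ≤ 1.
  · refine abs_le_of_sq_le_sq' ?_ hy.le |>.2
    rw [mul_pow, Real.sq_sqrt hpos.le]
    have h2 : ∑ a, v a ^ 2 ≤ (1 + 2 * x) * y ^ 2 := by linarith
    calc (1 - x) ^ 2 * ∑ a, v a ^ 2 ≤ (1 - x) ^ 2 * ((1 + 2 * x) * y ^ 2) := by gcongr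
      _ = (1 - x ^ 2 * (3 - 2 * x)) * y ^ 2 := by ring
      _ ≤ 1 * y ^ 2 := by
        gcongr
        nlinarith [mul_nonneg (sq_nonneg x) (by linarith : (0 : ℝ) ≤ 3 - 2 * x)]
      _ = y ^ 2 := one_mul _

theorem sum_mul_rawSample {n m : ℕ} (L : MvPolynomial (Fin n) ℝ →ₗ[ℝ] ℝ) (ω : ℕ → ℝ)
    (c : Fin n → ℝ) :
    ∑ a, c a * rawSample m L ω a = alongComp L c (blocks (m + 1) n ω) := by
  rw [alongComp, coordForm_eq_sum_smul c]
  simp only [Finset.mul_sum, map_sum, mul_smul_comm, map_smul, smul_eq_mul, rawSample]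

theorem sum_rawSample_sub_sq {n m : ℕ} (L : MvPolynomial (Fin n) ℝ →ₗ[ℝ] ℝ) (ω : ℕ → ℝ)
    (c : Fin n → ℝ) :
    ∑ a, (rawSample m L ω a - c a * alongComp L c (blocks (m + 1) n ω)) ^ 2
      = perpSq L c (blocks (m + 1) n ω) := by
  refine Finset.sum_congr rfl fun a _ => ?_
  rw [perpForm, ← MvPolynomial.smul_eq_C_mul, mul_sub, mul_sub, map_sub, mul_smul_comm,
    mul_smul_comm, map_smul, smul_eq_mul]
  rfl

/-- As 192e ≤ e^12 ≤ e^(1/ε), four times the second-moment constant is at most e^(4/ε). With log 2 ≥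
1/2 this already gives 2^(-4k/ε) for k = 2m + 2; the fourth power of ε appears only because one
constant serves as both factor and exponent. -/
theorem two_rpow_le {ε : ℝ} (h0 : 0 < ε) (hε : ε ≤ 1 / 12) (m : ℕ) :
    (2 : ℝ) ^ (-((4 : ℝ) * (2 * m + 2 : ℕ) / ε ^ 4))
      ≤ 1 / (4 * secondMomentConst (ε⁻¹) ^ (m + 1)) := by
  have hs : 12 ≤ ε⁻¹ := by
    rw [le_inv_comm₀ (by norm_num) h0]
    linarith
  have h1 : ε⁻¹ ≤ (ε ^ 4)⁻¹ := by
    rw [inv_le_inv₀ h0 (by positivity)]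
    calc ε ^ 4 = ε * ε ^ 3 := by ring
      _ ≤ ε * 1 := by
        gcongr
        exact pow_le_one₀ h0.le (by linarith)
      _ = ε := mul_one _
  have h2 : 4 * secondMomentConst (ε⁻¹) ^ (m + 1) ≤ Real.exp (4 * ε⁻¹) ^ (m + 1) := by
    calc 4 * secondMomentConst (ε⁻¹) ^ (m + 1)
        ≤ 4 ^ (m + 1) * secondMomentConst (ε⁻¹) ^ (m + 1) := by
          gcongr
          · exact (pow_pos (by unfold secondMomentConst; positivity) _).le
          · exact le_self_pow₀ (by norm_num) (by omega)
      _ = (4 * secondMomentConst (ε⁻¹)) ^ (m + 1) := (mul_pow _ _ _).symm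
      _ ≤ Real.exp (4 * ε⁻¹) ^ (m + 1) := by
          have h3 : (192 : ℝ) * Real.exp 1 ≤ Real.exp (ε⁻¹) := by
            have h4 : Real.exp 12 ≤ Real.exp (ε⁻¹) := Real.exp_le_exp.mpr hs
            have h5 : Real.exp 12 = Real.exp 1 ^ 12 := by
              rw [← Real.exp_nat_mul]
              norm_num
            have h6 : (2 : ℝ) ^ 11 ≤ Real.exp 1 ^ 11 := by
              gcongr
              linarith [Real.add_one_le_exp 1]
            nlinarith [Real.exp_pos 1]
          have h7 : 4 * secondMomentConst (ε⁻¹)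
              = 192 * Real.exp 1 * Real.exp (3 * ε⁻¹) := by
            rw [secondMomentConst, Real.exp_add]
            ring
          have h8 : Real.exp (4 * ε⁻¹) = Real.exp ε⁻¹ * Real.exp (3 * ε⁻¹) := by
            rw [← Real.exp_add]
            ring_nf
          have h9 : 0 ≤ 4 * secondMomentConst (ε⁻¹) := by
            unfold secondMomentConst
            positivity
          rw [h8]
          refine pow_le_pow_left₀ h9 ?_ _
          rw [h7]
          gcongr
  have hB : 0 < 4 * secondMomentConst (ε⁻¹) ^ (m + 1) := by
    unfold secondMomentConst
    positivity
  refine le_trans ?_ (one_div_le_one_div_of_le hB h2)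
  rw [Real.rpow_def_of_pos two_pos, one_div, ← Real.exp_nat_mul, ← Real.exp_neg]
  refine Real.exp_le_exp.mpr ?_
  have h3 : (1 : ℝ) / 2 ≤ Real.log 2 := by linarith [Real.log_two_gt_d9]
  rw [div_eq_mul_inv, mul_neg, neg_le_neg_iff]
  push_cast
  have h4 : 0 ≤ (4 : ℝ) * (2 * m + 2) * (ε ^ 4)⁻¹ := by positivity
  calc ((m : ℝ) + 1) * (4 * ε⁻¹) = 1 / 2 * (4 * (2 * m + 2) * ε⁻¹) := by ring
    _ ≤ 1 / 2 * (4 * (2 * m + 2) * (ε ^ 4)⁻¹) := by gcongr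
    _ ≤ Real.log 2 * (4 * (2 * m + 2) * (ε ^ 4)⁻¹) := by gcongr

end RealRAM

theorem mainTheorem4 :
    ∃ T A D : ℕ, ∀ k : ℕ, Even k → 0 < k → ∃ p : RealRAM.Program,
      ∀ (n : ℕ) (L : MvPolynomial (Fin n) ℝ →ₗ[ℝ] ℝ),
        IsPseudoExpectation k L → SatisfiesEqZero k L (spherePoly n) →
          (∀ ω : ℕ → ℝ, ∃ (s : RealRAM.State) (t : ℕ),
            RealRAM.Exec ω p (RealRAM.init n (momentList k L)) s t ∧
              t ≤ (max n 2) ^ (T * k)) ∧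
          ∀ (ε : ℝ) (c : EuclideanSpace ℝ (Fin n)), 0 < ε → ‖c‖ = 1 →
            Real.exp (-(ε * k)) ≤ L (linForm c ^ k) →
              ENNReal.ofReal ((2 : ℝ) ^ (-((D : ℝ) * k / ε ^ D))) ≤
                RealRAM.gaussianSeq {ω : ℕ → ℝ | ∃ (s : RealRAM.State) (t : ℕ),
                  RealRAM.Exec ω p (RealRAM.init n (momentList k L)) s t ∧
                    ‖s.output n‖ = 1 ∧ 1 - (A : ℝ) * ε ≤ inner ℝ c (s.output n)} := by
  -- 48 is half of the 96 in the bound on the orthogonal part: a squared tangent of at most 2x gives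
  -- a cosine of at least 1 − x.
  refine ⟨10, 48, 4, fun k hk hk0 => ?_⟩
  obtain ⟨m, rfl⟩ : ∃ m, k = 2 * m + 2 := by
    obtain ⟨r, hr⟩ := hk
    exact ⟨r - 1, by omega⟩
  refine ⟨RealRAM.sampler m, fun n L hL hS => ⟨fun ω => ?_, fun ε c hε hc hmom => ?_⟩⟩
  · obtain ⟨s, t, h, ht, -⟩ := RealRAM.exists_exec_sampler m L ω
    exact ⟨s, t, h, ht.trans (RealRAM.time_bound n m)⟩
  have hn : 0 < n := by
    rcases Nat.eq_zero_or_pos n with rfl | h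
    · rw [Subsingleton.elim c 0, norm_zero] at hc
      exact absurd hc zero_ne_one
    · exact h
  have hcs : ∑ i, c i ^ 2 = 1 := by
    have := EuclideanSpace.norm_sq_eq c
    simpa [hc] using this.symm
  have hprob : IsProbabilityMeasure RealRAM.gaussianSeq := by
    unfold RealRAM.gaussianSeq
    infer_instance
  have hpos := hL.isSphericalPositive hS (d := m + 1) (by ring)
  -- The analysis needs τ² = 1/ε ≥ 12. For larger ε, 1 − 48ε < −1, and it suffices that the output
  -- is always a unit vector, which the default for a zero sample guarantees.
  rcases lt_or_ge (1 / 12) ε with hlarge | hsmall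
  · have huniv : {ω : ℕ → ℝ | ∃ (s : RealRAM.State) (t : ℕ),
        RealRAM.Exec ω (RealRAM.sampler m) (RealRAM.init n (momentList (2 * m + 2) L)) s t ∧
          ‖s.output n‖ = 1 ∧ 1 - ((48 : ℕ) : ℝ) * ε ≤ inner ℝ c (s.output n)} = Set.univ := by
      refine Set.eq_univ_of_forall fun ω => ?_
      obtain ⟨s, t, h, -, hout⟩ := RealRAM.exists_exec_sampler m L ω
      have hnorm : ‖s.output n‖ = 1 := hout ▸ RealRAM.norm_output_eq_one hn _
      refine ⟨s, t, h, hnorm, ?_⟩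
      have := (abs_le.mp (abs_real_inner_le_norm c (s.output n))).1
      rw [hc, hnorm] at this
      push_cast
      linarith
    rw [huniv, measure_univ]
    refine ENNReal.ofReal_le_one.mpr (Real.rpow_le_one_of_one_le_of_nonpos one_le_two ?_)
    rw [neg_nonpos]
    positivity
  · have hτ : Real.sqrt ε⁻¹ ^ 2 = ε⁻¹ := Real.sq_sqrt (inv_nonneg.mpr hε.le)
    have hgood := hpos.le_measureReal_good hL.map_one (c := fun i => c i) hcs
      (τ := Real.sqrt ε⁻¹) (Real.sqrt_pos.mpr (inv_pos.mpr hε)) (by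
        rw [hτ, le_inv_comm₀ (by norm_num) hε]
        linarith) (by
        rw [hτ, inv_inv, ← Real.exp_nat_mul]
        refine le_trans (le_of_eq ?_) hmom
        congr 1
        push_cast
        ring)
    rw [hτ] at hgood
    have hmp := measurePreserving_blocks (m + 1) n
    rw [measureReal_def, ← hmp.measure_preimage (measurableSet_good L _ _).nullMeasurableSet,
      ← measureReal_def] at hgood
    calc ENNReal.ofReal ((2 : ℝ) ^ (-(((4 : ℕ) : ℝ) * (2 * m + 2 : ℕ) / ε ^ 4)))
        ≤ ENNReal.ofReal (1 / (4 * secondMomentConst ε⁻¹ ^ (m + 1))) :=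
          ENNReal.ofReal_le_ofReal (by exact_mod_cast RealRAM.two_rpow_le hε hsmall m)
      _ ≤ ENNReal.ofReal (RealRAM.gaussianSeq.real _) := ENNReal.ofReal_le_ofReal hgood
      _ = RealRAM.gaussianSeq _ := ofReal_measureReal
      _ ≤ _ := measure_mono ?_
    intro ω hω
    obtain ⟨hy, hp⟩ := hω
    obtain ⟨s, t, h, -, hout⟩ := RealRAM.exists_exec_sampler m L ω
    refine ⟨s, t, h, hout ▸ RealRAM.norm_output_eq_one hn _, ?_⟩
    rw [hout]
    refine RealRAM.one_sub_le_inner hcs hy (RealRAM.sum_mul_rawSample L ω _) ?_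
    refine le_trans (le_of_eq (RealRAM.sum_rawSample_sub_sq L ω fun i => c i)) (hp.trans_eq ?_)
    rw [div_inv_eq_mul]
    push_cast
    ring
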